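/- Call a topological space $X$ monotonically normal if there is an operator $H$ assigning to each pair $(p,U)$ with $U\subseteq X$ open and $p\in U$ an open set $H(p,U)$ such that (1) $p\in H(p,U)\subseteq U$; (2) $H(p,U)\cap H(q,V)=\emptyset$ whenever $p\notin V$ and $q\notin U$; (3) $H(p,V)\subseteq H(p,U)$ whenever $p\in V\subseteq U$. For a family $F$ of continuous functions $X\to\mathbb R$, let $X/F$ be the quotient space of $X$ by the relation: $f(x)=f(y)$ for all $f\in F$. For a cardinal $\chi$, let $H(\chi)$ be the collection of all sets hereditarily of cardinality $<\chi$. For an elementary submodel $M$ of $\langle H(\chi),\in\rangle$, let $x=_M y$ mean that $f(x)=f(y)$ for every continuous $f:X\to\mathbb R$ with $f\in M$, and let $X/M$ be the set of $=_M$-classes with the topology generated by the images of those co-zero sets of $X$ that are elements of $M$; let $\pi_M:X\to X/M$ be the projection. Let $X$ be a separable monotonically normal compact Hausdorff space. Then: (a) There are a separable metric space $Y$, which is compact and has countable weight, and a continuous surjection $g:X\to Y$ such that $|g^{-1}(y)|\le 2$ for every $y\in Y$. (b) There is a countable family $F$ of continuous functions $X\to\mathbb R$ such that $X/F$ is compact,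 metrizable, separable and of countable weight, and every fibre of the projection $X\to X/F$ has at most $2$ points. (c) For every sufficiently large regular cardinal $\chi$ (that is, every regular $\chi\ge\chi_0$, where $\chi_0$ depends on $X$), there is a countable elementary submodel $M$ of $H(\chi)$ with $(X,\tau)\in M$, where $\tau$ is the topology of $X$; and for every such $M$, the set of continuous functions $X\to\mathbb R$ belonging to $M$ is countable, the space $X/M$ is compact, metrizable, separable and of countable weight, $\pi_M$ is a (continuous, surjective) topological quotient map, and every fibre of $\pi_M$ has at most $2$ points. -/

import Mathlib

universe u

namespace SepMN

/-- `X` is monotonically normal: there is an operator assigning to every point `p` and every open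
set `U` containing `p` an open set `H p U` with `p ∈ H p U ⊆ U`, monotone in `U`, and such that
`H p U` and `H q V` are disjoint whenever `p ∉ V` and `q ∉ U`. The values of `H` at pairs `(p, U)`
that are not of this kind are irrelevant. -/
def MonotonicallyNormal (X : Type u) [TopologicalSpace X] : Prop :=
  ∃ H : X → Set X → Set X,
    (∀ p U, IsOpen U → p ∈ U → IsOpen (H p U) ∧ p ∈ H p U ∧ H p U ⊆ U) ∧
    (∀ p q U V, IsOpen U → IsOpen V → p ∈ U → q ∈ V → p ∉ V → q ∉ U →
      H p U ∩ H q V = ∅) ∧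
    (∀ p U V, IsOpen U → IsOpen V → p ∈ V → V ⊆ U → H p V ⊆ H p U)

/-! ### Elementary submodels of `H(χ)` -/

/-- The only symbol of the language of set theory: membership. -/
inductive SetRel : ℕ → Type
  | mem : SetRel 2

/-- The first-order language of set theory (equality is logical). -/
def setLang : FirstOrder.Language := ⟨fun _ => Empty, SetRel⟩

/-- `H(χ)`, the collection of the sets that are hereditarily of cardinality `< χ`. -/
def HSet (χ : Cardinal.{u}) : Set ZFSet.{u} :=
  {x | x.Hereditarily fun y => y.card < χ}

/-- The structure `⟨H(χ), ∈⟩`. -/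
instance instStructureHSet (χ : Cardinal.{u}) : setLang.Structure (HSet χ) where
  funMap := fun f => Empty.elim f
  RelMap := fun r =>
    match r with
    | SetRel.mem => fun v => (v 0 : ZFSet.{u}) ∈ (v 1 : ZFSet.{u})

/-- `M` is (the underlying set of) an elementary submodel of `⟨H(χ), ∈⟩`. -/
def IsElementarySubmodel (χ : Cardinal.{u}) (M : Set ZFSet.{u}) : Prop :=
  ∃ S : setLang.ElementarySubstructure (HSet χ), M = Subtype.val '' (S : Set (HSet χ))

/-! ### Sets representing the points, the topology, and the real-valued functions of a space

The points of `X` are identified with sets by an injection `c : X → ZFSet`. -/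

/-- The von Neumann natural number `n`. -/
noncomputable def natCode : ℕ → ZFSet.{u}
  | 0 => ∅
  | n + 1 => insert (natCode n) (natCode n)

/-- The real number `r` as a set: its lower Dedekind cut, a rational `(a - b) / (d + 1)` being given
by the triples `(a, b, d)` of natural numbers that represent it. -/
noncomputable def realCode (r : ℝ) : ZFSet.{u} :=
  ZFSet.range fun t : {t : ℕ × ℕ × ℕ // ((t.1 : ℝ) - t.2.1) / (t.2.2 + 1) < r} =>
    ZFSet.pair (natCode t.1.1) (ZFSet.pair (natCode t.1.2.1) (natCode t.1.2.2))

variable {X : Type u}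

/-- The subset `U` of `X` as a set. -/
noncomputable def subsetCode (c : X → ZFSet.{u}) (U : Set X) : ZFSet.{u} :=
  ZFSet.range fun x : U => c x

/-- The function `f : X → ℝ` as a set: its graph. -/
noncomputable def funCode (c : X → ZFSet.{u}) (f : X → ℝ) : ZFSet.{u} :=
  ZFSet.range fun x : X => ZFSet.pair (c x) (realCode (f x))

variable [TopologicalSpace X]

/-- The topological space `X` as a set: the pair `(X, τ)`. -/
noncomputable def spaceCode (c : X → ZFSet.{u}) : ZFSet.{u} :=
  ZFSet.pair (subsetCode c Set.univ)
    (ZFSet.range fun U : {U : Set X // IsOpen U} => subsetCode c U.1)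

/-! ### The quotients -/

/-- The equivalence relation on `X` of not being separated by any member of the family `F`. -/
def familySetoid (F : Set C(X, ℝ)) : Setoid X where
  r x y := ∀ f ∈ F, f x = f y
  iseqv := ⟨fun _ _ _ => rfl, fun h f hf => (h f hf).symm,
    fun h₁ h₂ f hf => (h₁ f hf).trans (h₂ f hf)⟩

/-- The continuous functions `X → ℝ` that belong to `M`. -/
def functionsIn (c : X → ZFSet.{u}) (M : Set ZFSet.{u}) : Set C(X, ℝ) :=
  {f | funCode c f ∈ M}

/-- `U` is a co-zero set. -/
def IsCozero (U : Set X) : Prop := ∃ f : C(X, ℝ), U = {x | f x ≠ 0}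

/-- `X/M`: the set of classes of the relation `f x = f y` for all continuous `f : X → ℝ` in `M`.
It does not carry the quotient topology by definition, see `instTopologicalSpaceModel`. -/
def ModelQuotient (c : X → ZFSet.{u}) (M : Set ZFSet.{u}) : Type u :=
  Quotient (familySetoid (functionsIn c M))

/-- The projection `X → X/M`. -/
def modelProj (c : X → ZFSet.{u}) (M : Set ZFSet.{u}) : X → ModelQuotient c M :=
  Quotient.mk (familySetoid (functionsIn c M))

/-- The topology of `X/M` is generated by the images of the co-zero sets that belong to `M`. -/
instance instTopologicalSpaceModel (c : X → ZFSet.{u}) (M : Set ZFSet.{u}) :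
    TopologicalSpace (ModelQuotient c M) :=
  TopologicalSpace.generateFrom
    {W | ∃ U : Set X, IsCozero U ∧ subsetCode c U ∈ M ∧ W = modelProj c M '' U}

end SepMN

namespace SepMN

section

open Set TopologicalSpace

/-! ### Recursion of length `ω₁` -/

/-! The core is a countable family `F` of continuous functions that leaves no three distinct points
unseparated. The operator enters mainly through `IsMNOperator.mem_or_mem`: if `H p U` meets `H q V`,
then `p ∈ V` or `q ∈ U`.

Together with separability this excludes right separated `ω₁`-sequences
(`IsMNOperator.false_of_rightSeparated`). Hence `X` is hereditarily Lindelöf and perfectly normal,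
and every open set is a co-zero set. Any countable family then extends to a countable adequate one
(`IsMNOperator.exists_isAdequate`). For an adequate family, let `A`, `B` be disjoint neighbourhoods
of equivalent points `a`, `b`: equivalent points of `H a A` and `H b B` must lie in the class of `a`
(`IsMNOperator.familyEquiv_of_mem`).

If every countable family left some triple unseparated, recursion would give `ω₁` many triples, each
with an adequate family that extends the earlier ones and separates their chosen neighbourhoods. A
countable dense set lets uncountably many of them share one point per coordinate inside the doubly
shrunk neighbourhoods. For two such triples, at least two of the three earlier points lie in the
later neighbourhoods, so the later triple lies in the earlier class. The classes then decrease
strictly, and their open complements contradict the Lindelöf property.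

The quotient by `F` embeds in `ℝ^F`, which gives (a) and (b). For (c), `F` need not belong to `M`:
by elementarity `M` contains some sequence of continuous functions separating triples, and its terms
lie in `M` because the natural numbers do. The coding lemmas check that the notions involved are
definable in `H(χ)`. -/

theorem exists_uncountable_wellOrder :
    ∃ (I : Type) (_ : LinearOrder I), WellFoundedLT I ∧ Uncountable I ∧
      ∀ a : I, (Iio a).Countable := by
  refine ⟨(Cardinal.aleph 1).ord.ToType, inferInstance, inferInstance, ?_, fun a => ?_⟩
  · rw [← Cardinal.aleph0_lt_mk_iff, Cardinal.mk_toType, Cardinal.card_ord]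
    exact Cardinal.aleph0_lt_aleph_one
  · have h : Cardinal.mk (Cardinal.aleph 1).ord.ToType = Order.succ Cardinal.aleph0 := by simp
    have := Cardinal.mk_Iio_lt a (by simp)
    rwa [h, Order.lt_succ_iff, Cardinal.le_aleph0_iff_set_countable] at this

theorem exists_seq_of_forall_countable {I : Type*} [LinearOrder I] [WellFoundedLT I]
    (hI : ∀ a : I, (Iio a).Countable) {T : Type*} (P : Set T → T → Prop)
    (h : ∀ C : Set T, C.Countable → ∃ t, P C t) :
    ∃ s : I → T, ∀ a, P (s '' Iio a) (s a) := by
  classical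
  -- The recursion needs a total choice function; its value at an uncountable set is arbitrary, and
  -- `h ∅` supplies one.
  have h' : ∀ C : Set T, ∃ t, C.Countable → P C t := fun C => by
    by_cases hC : C.Countable
    · exact (h C hC).imp fun t ht _ => ht
    · exact ⟨(h ∅ countable_empty).choose, fun h => absurd h hC⟩
  choose g hg using h'
  let F : ∀ a : I, (∀ b, b < a → T) → T := fun a r => g {t | ∃ b, ∃ hb : b < a, r b hb = t}
  refine ⟨wellFounded_lt.fix F, fun a => ?_⟩
  have : wellFounded_lt.fix F a = g (wellFounded_lt.fix F '' Iio a) := by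
    rw [WellFounded.fix_eq]
    simp [F, image]
  rw [this]
  exact hg _ ((hI a).image _)

theorem exists_uncountable_fiber {I J : Type*} [Uncountable I] [Countable J] (f : I → J) :
    ∃ j, ¬ (f ⁻¹' {j}).Countable := by
  by_contra! h
  refine not_countable_univ (α := I) ?_
  rw [← preimage_univ (f := f), ← iUnion_of_singleton J, preimage_iUnion]
  exact countable_iUnion h

theorem exists_gt_of_not_countable {I : Type*} [LinearOrder I] (hI : ∀ a : I, (Iio a).Countable)
    {T : Set I} (hT : ¬ T.Countable) (a : I) : ∃ b ∈ T, a < b := by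
  by_contra! h
  refine hT (((hI a).insert a).mono fun b hb => ?_)
  rcases (h b hb).eq_or_lt with h | h
  exacts [Or.inl h, Or.inr h]

/-! ### Monotonically normal spaces -/

/-- `H` is an operator witnessing monotone normality (without the monotonicity clause). -/
structure IsMNOperator {X : Type*} [TopologicalSpace X] (H : X → Set X → Set X) : Prop where
  isOpen : ∀ {p U}, IsOpen U → p ∈ U → IsOpen (H p U)
  mem : ∀ {p U}, IsOpen U → p ∈ U → p ∈ H p U
  subset : ∀ {p U}, IsOpen U → p ∈ U → H p U ⊆ U
  inter_eq : ∀ {p q U V}, IsOpen U → IsOpen V → p ∈ U → q ∈ V → p ∉ V → q ∉ U →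
    H p U ∩ H q V = ∅

theorem MonotonicallyNormal.exists_operator {X : Type u} [TopologicalSpace X]
    (h : MonotonicallyNormal X) : ∃ H : X → Set X → Set X, IsMNOperator H := by
  obtain ⟨H, h1, h2, -⟩ := h
  exact ⟨H, fun hU hp => (h1 _ _ hU hp).1, fun hU hp => (h1 _ _ hU hp).2.1,
    fun hU hp => (h1 _ _ hU hp).2.2, fun hU hV => h2 _ _ _ _ hU hV⟩

section

variable {X : Type*} [TopologicalSpace X] {H : X → Set X → Set X}

theorem IsMNOperator.mem_or_mem (hH : IsMNOperator H) {p q x : X} {U V : Set X} (hU : IsOpen U)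
    (hV : IsOpen V) (hp : p ∈ U) (hq : q ∈ V) (hx : x ∈ H p U) (hx' : x ∈ H q V) :
    p ∈ V ∨ q ∈ U := by
  by_contra! h
  have := hH.inter_eq hU hV hp hq h.1 h.2
  exact (this ▸ ⟨hx, hx'⟩ : x ∈ (∅ : Set X))

/-- A right separated sequence of length `ω₁` does not exist in a separable monotonically normal
space. -/
theorem IsMNOperator.false_of_rightSeparated [T1Space X] [SeparableSpace X]
    (hH : IsMNOperator H) {I : Type*} [LinearOrder I] [WellFoundedLT I] [Uncountable I]
    (hI : ∀ a : I, (Iio a).Countable) (x : I → X) (V : I → Set X) (hV : ∀ a, IsOpen (V a))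
    (hx : ∀ a, x a ∈ V a) (hxV : ∀ a b, a < b → x b ∉ V a) : False := by
  obtain ⟨D, hDc, hD⟩ := exists_countable_dense X
  have : Countable D := hDc
  -- Shrinking twice puts the earlier points of an uncountable subsequence into `O b` rather than
  -- just into `V b`; the second use of the operator below needs this.
  let O : I → Set X := fun a => H (x a) (V a)
  have hO : ∀ a, IsOpen (O a) := fun a => hH.isOpen (hV a) (hx a)
  have hxO : ∀ a, x a ∈ O a := fun a => hH.mem (hV a) (hx a)
  have hd : ∀ a, ∃ d : D, (d : X) ∈ H (x a) (O a) := fun a => by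
    obtain ⟨d, hd, hdD⟩ := hD.inter_open_nonempty _ (hH.isOpen (hO a) (hxO a))
      ⟨_, hH.mem (hO a) (hxO a)⟩
    exact ⟨⟨d, hdD⟩, hd⟩
  choose d hd using hd
  obtain ⟨e, he⟩ := exists_uncountable_fiber d
  set T : Set I := d ⁻¹' {e}
  have hT : ∀ a ∈ T, ∀ b ∈ T, a < b → x a ∈ O b := by
    intro a ha b hb hab
    have h1 := hd a
    have h2 := hd b
    rw [show d a = e from ha] at h1
    rw [show d b = e from hb] at h2
    refine (hH.mem_or_mem (hO a) (hO b) (hxO a) (hxO b) h1 h2).resolve_right fun h => ?_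
    exact hxV a b hab (hH.subset (hV a) (hx a) h)
  -- `s a` is the successor of `a` within `T`.
  have hs : ∀ a, ∃ b, b ∈ T ∧ a < b ∧ ∀ c ∈ T, a < c → b ≤ c := fun a => by
    obtain ⟨b, hb⟩ := exists_gt_of_not_countable hI he a
    have hne : {b | b ∈ T ∧ a < b}.Nonempty := ⟨b, hb⟩
    have hmem := WellFounded.min_mem (wellFounded_lt (α := I)) _ hne
    exact ⟨_, hmem.1, hmem.2, fun c hc hac => WellFounded.min_le wellFounded_lt
      (show c ∈ {b | b ∈ T ∧ a < b} from ⟨hc, hac⟩)⟩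
  choose s hsT hlt hle using hs
  -- The first factor keeps later points out of `W a`. The second keeps out the earlier successor
  -- points, since these lie in `O a = H (x a) (V a)` while `x (s a) ∉ V a`.
  let W : I → Set X := fun a => V (s a) ∩ H (x (s a)) {x a}ᶜ
  have hne : ∀ a, x (s a) ∈ ({x a}ᶜ : Set X) := fun a h =>
    hxV a (s a) (hlt a) (by rw [show x (s a) = x a from h]; exact hx a)
  have hW : ∀ a, IsOpen (W a) := fun a =>
    (hV _).inter (hH.isOpen isOpen_compl_singleton (hne a))
  have hxW : ∀ a, x (s a) ∈ W a := fun a => ⟨hx _, hH.mem isOpen_compl_singleton (hne a)⟩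
  have hd' : ∀ a, ∃ d : D, (d : X) ∈ H (x (s a)) (W a) := fun a => by
    obtain ⟨d, hd, hdD⟩ := hD.inter_open_nonempty _ (hH.isOpen (hW a) (hxW a))
      ⟨_, hH.mem (hW a) (hxW a)⟩
    exact ⟨⟨d, hdD⟩, hd⟩
  choose d' hd' using hd'
  -- So `d'` is injective on the uncountable set `T`, with values in the countable set `D`.
  have hlt' : ∀ a ∈ T, ∀ b ∈ T, a < b → d' a ≠ d' b := by
    intro a ha b hb hab hdd
    have h1 := hd' a
    rw [hdd] at h1
    have hsa : s a ≤ b := hle a b hb hab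
    rcases hH.mem_or_mem (hW a) (hW b) (hxW a) (hxW b) h1 (hd' b) with h | h
    · have h3 : x (s a) ∈ O b := by
        rcases hsa.eq_or_lt with h | h
        · rw [h]; exact hxO b
        · exact hT _ (hsT a) b hb h
      rcases hH.mem_or_mem (hV b) isOpen_compl_singleton (hx b) (hne b) h3 h.2 with h4 | h4
      · exact h4 rfl
      · exact hxV b _ (hlt b) h4
    · exact hxV (s a) (s b) (hsa.trans_lt (hlt b)) h.1
  refine he (MapsTo.countable_of_injOn (mapsTo_univ d' T) ?_ countable_univ)
  intro a ha b hb hab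
  rcases lt_trichotomy a b with h | h | h
  · exact absurd hab (hlt' a ha b hb h)
  · exact h
  · exact absurd hab.symm (hlt' b hb a ha h)

/-- A cover without a countable subcover lets one choose, `ω₁` times, a point outside all cover
members picked so far; the result is right separated. -/
theorem IsMNOperator.hereditarilyLindelofSpace [T1Space X] [SeparableSpace X]
    (hH : IsMNOperator H) : HereditarilyLindelofSpace X := by
  refine HereditarilyLindelofSpace.of_forall_isOpen fun s _ => ?_
  rw [isLindelof_iff_countable_subcover]
  intro ι U hU hs
  by_contra! hcon
  obtain ⟨I, _, _, _, hI⟩ := exists_uncountable_wellOrder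
  obtain ⟨t, ht⟩ := exists_seq_of_forall_countable hI
    (fun (C : Set (X × ι)) (t : X × ι) => t.1 ∈ U t.2 ∧ ∀ t' ∈ C, t.1 ∉ U t'.2) (fun C hC => by
      obtain ⟨x, hxs, hx⟩ := not_subset.1 (hcon (Prod.snd '' C) (hC.image _))
      obtain ⟨i, hi⟩ := mem_iUnion.1 (hs hxs)
      exact ⟨(x, i), hi, fun t' ht' h => hx (mem_biUnion (mem_image_of_mem _ ht') h)⟩)
  exact hH.false_of_rightSeparated hI (fun a => (t a).1) (fun a => U (t a).2) (fun a => hU _)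
    (fun a => (ht a).1) fun a b hab => (ht b).2 _ ⟨a, hab, rfl⟩

end

/-- By regularity and the Lindelöf property, the complement of a closed set is a countable union of
closures of open sets. -/
theorem perfectlyNormalSpace_of_hereditarilyLindelof {X : Type*} [TopologicalSpace X] [T4Space X]
    [HereditarilyLindelofSpace X] : PerfectlyNormalSpace X where
  closed_gdelta := by
    intro s hs
    have h : ∀ x : (sᶜ : Set X), ∃ V : Set X, IsOpen V ∧ (x : X) ∈ V ∧ closure V ⊆ sᶜ := fun x => by
      obtain ⟨V, hV, hxV, hVs⟩ := normal_exists_closure_subset (s := {(x : X)}) isClosed_singleton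
        hs.isOpen_compl (singleton_subset_iff.2 x.2)
      exact ⟨V, hV, hxV rfl, hVs⟩
    choose V hV hxV hVs using h
    obtain ⟨t, htc, ht⟩ := (HereditarilyLindelofSpace.isLindelof (sᶜ)).elim_countable_subcover V hV
      fun x hx => mem_iUnion.2 ⟨⟨x, hx⟩, hxV _⟩
    have : s = ⋂ i ∈ t, (closure (V i))ᶜ := by
      ext x
      simp only [mem_iInter, mem_compl_iff]
      refine ⟨fun hx i _ h => hVs i h hx, fun h => ?_⟩
      by_contra hx
      obtain ⟨i, hi, hxi⟩ := mem_iUnion₂.1 (ht hx)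
      exact h i hi (subset_closure hxi)
    rw [this]
    exact IsGδ.biInter htc fun i _ => isClosed_closure.isOpen_compl.isGδ

theorem isCozero_of_isOpen {X : Type u} [TopologicalSpace X] [PerfectlyNormalSpace X] {U : Set X}
    (hU : IsOpen U) : IsCozero U := by
  obtain ⟨f, hf, -⟩ := perfectlyNormalSpace_iff_forall_isClosed_preimage_zero.1 ‹_› Uᶜ
    hU.isClosed_compl
  refine ⟨f, ?_⟩
  ext x
  have := congrArg (x ∈ ·) hf
  simp only [mem_compl_iff, mem_preimage, mem_singleton_iff, eq_iff_iff] at this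
  rw [mem_ofPred_eq, ← not_iff_not, this, not_not]

end

/-! ### Adequate families and triples of unseparated points -/

section

open Set TopologicalSpace

section

variable {X : Type u} [TopologicalSpace X]

/-- No member of `F` separates `x` from `y`. -/
def FamilyEquiv (F : Set C(X, ℝ)) (x y : X) : Prop := ∀ f ∈ F, f x = f y

theorem FamilyEquiv.symm {F : Set C(X, ℝ)} {x y : X} (h : FamilyEquiv F x y) :
    FamilyEquiv F y x := fun f hf => (h f hf).symm

theorem FamilyEquiv.trans {F : Set C(X, ℝ)} {x y z : X} (h : FamilyEquiv F x y)
    (h' : FamilyEquiv F y z) : FamilyEquiv F x z := fun f hf => (h f hf).trans (h' f hf)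

theorem FamilyEquiv.mono {F G : Set C(X, ℝ)} (hFG : F ⊆ G) {x y : X} (h : FamilyEquiv G x y) :
    FamilyEquiv F x y := fun f hf => h f (hFG hf)

theorem isClosed_familyEquiv (F : Set C(X, ℝ)) (x : X) : IsClosed {y | FamilyEquiv F x y} := by
  simp only [FamilyEquiv, ofPred_forall]
  exact isClosed_biInter fun f _ => isClosed_eq continuous_const f.continuous

/-- `U` is a union of classes of `FamilyEquiv F`. -/
def IsSaturated (F : Set C(X, ℝ)) (U : Set X) : Prop :=
  ∀ x y, FamilyEquiv F x y → x ∈ U → y ∈ U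

theorem isSaturated_of_mem {F : Set C(X, ℝ)} {f : C(X, ℝ)} (hf : f ∈ F) :
    IsSaturated F {x | f x ≠ 0} := fun x y h hx => by
  rw [mem_ofPred_eq, ← h f hf]
  exact hx

/-- Distinct classes of `FamilyEquiv F` are separated by the values of the operator `H`. -/
def IsAdequate (H : X → Set X → Set X) (F : Set C(X, ℝ)) : Prop :=
  ∀ x y, ¬ FamilyEquiv F x y → ∃ U d, IsOpen U ∧ d ∈ U ∧ (∀ z, FamilyEquiv F y z → z ∉ U) ∧
    ∀ z, FamilyEquiv F x z → z ∈ H d U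

theorem exists_countable_superset_closed {T : Type*} (Φ : T → Set T) (hΦ : ∀ t, (Φ t).Countable)
    {F₀ : Set T} (hF₀ : F₀.Countable) :
    ∃ F, F.Countable ∧ F₀ ⊆ F ∧ ∀ t ∈ F, Φ t ⊆ F := by
  let step : Set T → Set T := fun F => F ∪ ⋃ t ∈ F, Φ t
  have hc : ∀ n, (step^[n] F₀).Countable := fun n => by
    induction n with
    | zero => exact hF₀
    | succ n ih =>
      rw [Function.iterate_succ_apply']
      exact ih.union (ih.biUnion fun t _ => hΦ t)
  refine ⟨⋃ n, step^[n] F₀, countable_iUnion hc, subset_iUnion (fun n => step^[n] F₀) 0, ?_⟩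
  intro t ht
  obtain ⟨n, hn⟩ := mem_iUnion.1 ht
  refine Subset.trans ?_ (subset_iUnion (fun n => step^[n] F₀) (n + 1))
  simp only [Function.iterate_succ_apply']
  exact (subset_biUnion_of_mem (u := Φ) hn).trans subset_union_right

/-- Each open `U` is covered by countably many `H d U` with `d ∈ U`, and each of these is a co-zero
set. Close the family under adding the corresponding functions for all `U = {f < r}` and `U = {f >
r}`, with `f` in the family and `r` rational. Then the sets `H d U` used are unions of classes. -/
theorem IsMNOperator.exists_isAdequate [HereditarilyLindelofSpace X] [PerfectlyNormalSpace X]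
    {H : X → Set X → Set X} (hH : IsMNOperator H) {F₀ : Set C(X, ℝ)} (hF₀ : F₀.Countable) :
    ∃ F, F.Countable ∧ F₀ ⊆ F ∧ IsAdequate H F := by
  have hE : ∀ U, ∃ E : Set X, E.Countable ∧
      (IsOpen U → E ⊆ U ∧ ∀ x ∈ U, ∃ d ∈ E, x ∈ H d U) := fun U => by
    by_cases hU : IsOpen U
    · obtain ⟨t, htc, ht⟩ := (HereditarilyLindelofSpace.isLindelof U).elim_countable_subcover
        (fun d : U => H d U) (fun d => hH.isOpen hU d.2)
        fun x hx => mem_iUnion.2 ⟨⟨x, hx⟩, hH.mem hU hx⟩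
      refine ⟨Subtype.val '' t, htc.image _, fun _ => ⟨by simp, fun x hx => ?_⟩⟩
      obtain ⟨d, hd, hxd⟩ := mem_iUnion₂.1 (ht hx)
      exact ⟨d, mem_image_of_mem _ hd, hxd⟩
    · exact ⟨∅, countable_empty, fun h => absurd h hU⟩
  choose E hEc hE using hE
  have hcz : ∀ U : Set X, ∃ g : C(X, ℝ), IsOpen U → U = {x | g x ≠ 0} := fun U => by
    by_cases hU : IsOpen U
    · exact (isCozero_of_isOpen hU).imp fun g hg _ => hg
    · exact ⟨0, fun h => absurd h hU⟩
  choose cz hcz using hcz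
  let G : Set X → Set C(X, ℝ) := fun U => (fun d => cz (H d U)) '' E U
  let Φ : C(X, ℝ) → Set C(X, ℝ) := fun f => ⋃ r : ℚ, G {x | f x < r} ∪ G {x | (r : ℝ) < f x}
  obtain ⟨F, hFc, hF₀F, hF⟩ := exists_countable_superset_closed Φ
    (fun f => countable_iUnion fun r => ((hEc _).image _).union ((hEc _).image _)) hF₀
  refine ⟨F, hFc, hF₀F, fun x y hxy => ?_⟩
  have key : ∀ U : Set X, IsOpen U → x ∈ U → (∀ z, FamilyEquiv F y z → z ∉ U) → G U ⊆ F →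
      ∃ U d, IsOpen U ∧ d ∈ U ∧ (∀ z, FamilyEquiv F y z → z ∉ U) ∧
        ∀ z, FamilyEquiv F x z → z ∈ H d U := fun U hU hxU hyU hGU => by
    obtain ⟨d, hdE, hxd⟩ := (hE U hU).2 x hxU
    have hdU := (hE U hU).1 hdE
    refine ⟨U, d, hU, hdU, hyU, fun z hz => ?_⟩
    have hg := isSaturated_of_mem (hGU (mem_image_of_mem _ hdE)) x z hz
    rw [← hcz _ (hH.isOpen hU hdU)] at hg
    exact hg hxd
  simp only [FamilyEquiv, not_forall] at hxy
  obtain ⟨f, hf, hne⟩ := hxy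
  have hGF : ∀ r : ℚ, G {x | f x < r} ∪ G {x | (r : ℝ) < f x} ⊆ F := fun r =>
    (subset_iUnion (fun r : ℚ => G {x | f x < r} ∪ G {x | (r : ℝ) < f x}) r).trans (hF f hf)
  rcases lt_or_gt_of_ne hne with h | h
  · obtain ⟨r, hr1, hr2⟩ := exists_rat_btwn h
    refine key {x | f x < r} (isOpen_lt f.continuous continuous_const) hr1 (fun z hz => ?_)
      (subset_union_left.trans (hGF r))
    simp only [mem_ofPred_eq, ← hz f hf, not_lt]
    exact hr2.le
  · obtain ⟨r, hr1, hr2⟩ := exists_rat_btwn h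
    refine key {x | (r : ℝ) < f x} (isOpen_lt continuous_const f.continuous) hr2 (fun z hz => ?_)
      (subset_union_right.trans (hGF r))
    simp only [mem_ofPred_eq, ← hz f hf, not_lt]
    exact hr1.le

/-- Otherwise adequacy gives `d ∈ U` with `a'`, `b'` in `H d U` and `a`, `b` outside `U`.
Disjointness of operator values then forces `d` into both `A` and `B`. -/
theorem IsMNOperator.familyEquiv_of_mem {H : X → Set X → Set X} (hH : IsMNOperator H)
    {F : Set C(X, ℝ)} (hF : IsAdequate H F) {a b a' b' : X} {A B : Set X} (hA : IsOpen A)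
    (hB : IsOpen B) (hAB : Disjoint A B) (ha : a ∈ A) (hb : b ∈ B) (hab : FamilyEquiv F a b)
    (ha' : a' ∈ H a A) (hb' : b' ∈ H b B) (hab' : FamilyEquiv F a' b') : FamilyEquiv F a' a := by
  by_contra hne
  obtain ⟨U, d, hU, hdU, haU, hd⟩ := hF _ _ hne
  have hda : a' ∈ H d U := hd _ fun _ _ => rfl
  have hdb : b' ∈ H d U := hd _ hab'
  have h1 := (hH.mem_or_mem hA hU ha hdU ha' hda).resolve_left (haU _ fun _ _ => rfl)
  have h2 := (hH.mem_or_mem hB hU hb hdU hb' hdb).resolve_left (haU _ hab)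
  exact disjoint_left.1 hAB h1 h2

/-- Three distinct points that are not separated by an adequate countable family, with disjoint
neighbourhoods. -/
structure UnseparatedTriple (H : X → Set X → Set X) where
  F : Set C(X, ℝ)
  x : Fin 3 → X
  A : Fin 3 → Set X
  countable : F.Countable
  adequate : IsAdequate H F
  equiv : ∀ i j, FamilyEquiv F (x i) (x j)
  isOpen : ∀ i, IsOpen (A i)
  mem : ∀ i, x i ∈ A i
  disjoint : ∀ i j, i ≠ j → Disjoint (A i) (A j)

theorem UnseparatedTriple.exists_of_injective [T2Space X] {H : X → Set X → Set X}
    {F : Set C(X, ℝ)} (hFc : F.Countable) (hF : IsAdequate H F) {x : Fin 3 → X}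
    (hx : Function.Injective x) (h : ∀ i j, FamilyEquiv F (x i) (x j)) :
    ∃ t : UnseparatedTriple H, t.F = F := by
  obtain ⟨U, hU, hd⟩ := (finite_range x).t2_separation
  exact ⟨⟨F, x, fun i => U (x i), hFc, hF, h, fun i => (hU _).2, fun i => (hU _).1,
    fun i j hij => hd (mem_range_self i) (mem_range_self j) (hx.ne hij)⟩, rfl⟩

theorem UnseparatedTriple.injective {H : X → Set X → Set X} (t : UnseparatedTriple H) :
    Function.Injective t.x := fun i j hij => by
  by_contra hne
  exact disjoint_left.1 (t.disjoint i j hne) (t.mem i) (hij ▸ t.mem j)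

/-- The family of `t` separates points as required by the triple `t'`. -/
structure UnseparatedTriple.Extends {H : X → Set X → Set X} (t' t : UnseparatedTriple H) :
    Prop where
  subset : t'.F ⊆ t.F
  saturated : ∀ i, IsSaturated t.F (H (t'.x i) (t'.A i))
  saturated_compl : IsSaturated t.F {t'.x 0}ᶜ

/-- In each coordinate the earlier point lies in the later shrunk neighbourhood or conversely. The
converse occurs at most once: the earlier shrunk neighbourhoods are saturated for the later family,
so one of them would contain the whole later triple. Three coordinates therefore leave two for
`IsMNOperator.familyEquiv_of_mem`. -/
theorem UnseparatedTriple.Extends.familyEquiv {H : X → Set X → Set X} (hH : IsMNOperator H)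
    {t' t : UnseparatedTriple H} (h : t'.Extends t)
    (hp : ∀ i, ∃ p, p ∈ H (t'.x i) (H (t'.x i) (t'.A i)) ∧ p ∈ H (t.x i) (H (t.x i) (t.A i))) :
    FamilyEquiv t'.F (t'.x 0) (t.x 0) := by
  have hO : ∀ (t : UnseparatedTriple H) i, IsOpen (H (t.x i) (t.A i)) := fun t i =>
    hH.isOpen (t.isOpen i) (t.mem i)
  have hm : ∀ (t : UnseparatedTriple H) i, t.x i ∈ H (t.x i) (t.A i) := fun t i =>
    hH.mem (t.isOpen i) (t.mem i)
  have hs : ∀ (t : UnseparatedTriple H) i, H (t.x i) (t.A i) ⊆ t.A i := fun t i =>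
    hH.subset (t.isOpen i) (t.mem i)
  have hor : ∀ i, t'.x i ∈ H (t.x i) (t.A i) ∨ t.x i ∈ H (t'.x i) (t'.A i) := fun i => by
    obtain ⟨p, hp1, hp2⟩ := hp i
    exact hH.mem_or_mem (hO t' i) (hO t i) (hm t' i) (hm t i) hp1 hp2
  have hnot : ∀ i j, i ≠ j → t.x i ∈ H (t'.x i) (t'.A i) → t.x j ∉ H (t'.x j) (t'.A j) :=
    fun i j hij hi hj => disjoint_left.1 (t'.disjoint i j hij)
      (hs _ _ (h.saturated i _ _ (t.equiv i j) hi)) (hs _ _ hj)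
  obtain ⟨i, j, hij, hi, hj⟩ : ∃ i j, i ≠ j ∧ t'.x i ∈ H (t.x i) (t.A i) ∧
      t'.x j ∈ H (t.x j) (t.A j) := by
    by_cases h0 : t.x 0 ∈ H (t'.x 0) (t'.A 0)
    · exact ⟨1, 2, by decide, (hor 1).resolve_right (hnot 0 1 (by decide) h0),
        (hor 2).resolve_right (hnot 0 2 (by decide) h0)⟩
    · by_cases h1 : t.x 1 ∈ H (t'.x 1) (t'.A 1)
      · exact ⟨0, 2, by decide, (hor 0).resolve_right h0,
          (hor 2).resolve_right (hnot 1 2 (by decide) h1)⟩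
      · exact ⟨0, 1, by decide, (hor 0).resolve_right h0, (hor 1).resolve_right h1⟩
  have he : ∀ i j, FamilyEquiv t'.F (t.x i) (t.x j) := fun i j => (t.equiv i j).mono h.subset
  have := hH.familyEquiv_of_mem t'.adequate (t.isOpen i) (t.isOpen j) (t.disjoint i j hij)
    (t.mem i) (t.mem j) (he i j) hi hj (t'.equiv i j)
  exact ((t'.equiv 0 i).trans this).trans (he i 0)

/-- The later family isolates `t'.x 0` in a one-point class, whereas the class of `t.x 0` contains
three points. -/
theorem UnseparatedTriple.Extends.not_familyEquiv {H : X → Set X → Set X}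
    {t' t : UnseparatedTriple H} (h : t'.Extends t) : ¬ FamilyEquiv t.F (t.x 0) (t'.x 0) := by
  intro he
  have h1 : ∀ i, t.x i = t'.x 0 := fun i => by
    by_contra hne
    exact h.saturated_compl _ _ ((t.equiv i 0).trans he) hne rfl
  exact absurd (t.injective ((h1 0).trans (h1 1).symm)) (by decide)

/-- Collect the families of the triples in `C` and functions whose co-zero sets are the sets to be
saturated, pass to an adequate countable family, and take a triple it fails to separate. -/
theorem UnseparatedTriple.exists_extends [T2Space X] [HereditarilyLindelofSpace X]
    [PerfectlyNormalSpace X] {H : X → Set X → Set X} (hH : IsMNOperator H)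
    (hbad : ∀ F : Set C(X, ℝ), F.Countable →
      ∃ x : Fin 3 → X, Function.Injective x ∧ ∀ i j, FamilyEquiv F (x i) (x j))
    {C : Set (UnseparatedTriple H)} (hC : C.Countable) :
    ∃ t : UnseparatedTriple H, ∀ t' ∈ C, t'.Extends t := by
  have hg : ∀ (t' : UnseparatedTriple H) i, ∃ g : C(X, ℝ),
      H (t'.x i) (t'.A i) = {x | g x ≠ 0} := fun t' i =>
    isCozero_of_isOpen (hH.isOpen (t'.isOpen i) (t'.mem i))
  have hk : ∀ (t' : UnseparatedTriple H), ∃ g : C(X, ℝ), {t'.x 0}ᶜ = {x | g x ≠ 0} := fun t' =>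
    isCozero_of_isOpen isOpen_compl_singleton
  choose g hg using hg
  choose k hk using hk
  obtain ⟨F, hFc, hF₀, hF⟩ := hH.exists_isAdequate
    (hC.biUnion fun t' _ => (t'.countable.union (countable_range (g t'))).union
      (countable_singleton (k t')))
  obtain ⟨x, hx, hxe⟩ := hbad F hFc
  obtain ⟨t, rfl⟩ := UnseparatedTriple.exists_of_injective hFc hF hx hxe
  refine ⟨t, fun t' ht' => ?_⟩
  have hsub : (t'.F ∪ range (g t')) ∪ {k t'} ⊆ t.F :=
    (subset_biUnion_of_mem (u := fun t' => (t'.F ∪ range (g t')) ∪ {k t'}) ht').trans hF₀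
  refine ⟨subset_union_left.trans (subset_union_left.trans hsub), fun i => ?_, ?_⟩
  · rw [hg]
    exact isSaturated_of_mem (hsub (Or.inl (Or.inr (mem_range_self i))))
  · rw [hk]
    exact isSaturated_of_mem (hsub (Or.inr rfl))

/-- In a separable monotonically normal space that is perfectly normal, some countable family of
continuous functions separates any three points. -/
theorem IsMNOperator.exists_countable_family [T2Space X] [SeparableSpace X]
    [HereditarilyLindelofSpace X] [PerfectlyNormalSpace X] {H : X → Set X → Set X}
    (hH : IsMNOperator H) : ∃ F : Set C(X, ℝ), F.Countable ∧
      ∀ x : Fin 3 → X, Function.Injective x → ¬ ∀ i j, FamilyEquiv F (x i) (x j) := by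
  by_contra! hbad
  obtain ⟨I, _, _, _, hI⟩ := exists_uncountable_wellOrder
  obtain ⟨t, ht⟩ := exists_seq_of_forall_countable hI
    (fun (C : Set (UnseparatedTriple H)) t => ∀ t' ∈ C, t'.Extends t)
    fun C hC => UnseparatedTriple.exists_extends hH hbad hC
  have hext : ∀ a b, a < b → (t a).Extends (t b) := fun a b hab => ht b _ ⟨a, hab, rfl⟩
  obtain ⟨D, hDc, hD⟩ := exists_countable_dense X
  have : Countable D := hDc
  have hp : ∀ a i, ∃ p : D, (p : X) ∈ H ((t a).x i) (H ((t a).x i) ((t a).A i)) := fun a i => by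
    have ho := hH.isOpen ((t a).isOpen i) ((t a).mem i)
    have hm := hH.mem ((t a).isOpen i) ((t a).mem i)
    obtain ⟨p, hp, hpD⟩ := hD.inter_open_nonempty _ (hH.isOpen ho hm) ⟨_, hH.mem ho hm⟩
    exact ⟨⟨p, hpD⟩, hp⟩
  choose p hp using hp
  -- Here `p a` is a triple of points of `D`; there are only countably many such triples.
  obtain ⟨q, hq⟩ := exists_uncountable_fiber p
  set T : Set I := p ⁻¹' {q}
  have hT : ∀ a ∈ T, ∀ b ∈ T, a < b → FamilyEquiv (t a).F ((t a).x 0) ((t b).x 0) := by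
    intro a ha b hb hab
    refine (hext a b hab).familyEquiv hH fun i => ⟨q i, ?_, ?_⟩
    · rw [← show p a = q from ha]; exact hp a i
    · rw [← show p b = q from hb]; exact hp b i
  -- The complements of the classes increase along `T`, and strictly so: `(t a).x 0` enters at every
  -- later index but is not in `U a`.
  let U : T → Set X := fun a => {x | FamilyEquiv (t a).F ((t a).x 0) x}ᶜ
  have hmono : ∀ a b : T, a.1 < b.1 → U a ⊆ U b := fun a b hab x hx hx' =>
    hx ((hT a a.2 b b.2 hab).trans (hx'.mono (hext _ _ hab).subset))
  have hmem : ∀ a b : T, a.1 < b.1 → (t a).x 0 ∈ U b := fun a b hab h =>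
    (hext _ _ hab).not_familyEquiv h
  obtain ⟨S, hSc, hS⟩ := eq_open_union_countable U
    fun a => (isClosed_familyEquiv _ _).isOpen_compl
  -- A countable subset of `T` is bounded, so the whole union is already contained in `U b`; but `(t
  -- b).x 0` belongs to the union.
  obtain ⟨b, hbT, hb⟩ : ∃ b ∈ T, ∀ a ∈ S, a.1 < b := by
    by_contra! hcon
    refine hq (((hSc.biUnion fun a _ => (hI a.1).insert a.1)).mono fun b hb => ?_)
    obtain ⟨a, ha, hab⟩ := hcon b hb
    refine mem_biUnion ha ?_
    rcases hab.eq_or_lt with h | h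
    exacts [Or.inl h, Or.inr h]
  obtain ⟨d, hdT, hd⟩ := exists_gt_of_not_countable hI hq b
  have h1 : (t b).x 0 ∈ ⋃ a, U a := mem_iUnion.2 ⟨⟨d, hdT⟩, hmem ⟨b, hbT⟩ ⟨d, hdT⟩ hd⟩
  rw [← hS] at h1
  obtain ⟨a, ha, h1⟩ := mem_iUnion₂.1 h1
  exact hmono a ⟨b, hbT⟩ (hb a ha) h1 fun _ _ => rfl

end

end

/-! ### Topology of the quotient spaces -/

section

open Set TopologicalSpace

theorem exists_injective_of_two_lt_encard {X : Type*} {s : Set X} (h : ¬ s.encard ≤ 2) :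
    ∃ x : Fin 3 → X, Function.Injective x ∧ ∀ i, x i ∈ s := by
  obtain ⟨t, hts, ht⟩ := exists_subset_encard_eq (k := 3)
    (show (3 : ℕ∞) ≤ s.encard from Order.add_one_le_of_lt (not_le.1 h))
  obtain ⟨a, b, c, hab, hac, hbc, rfl⟩ := encard_eq_three.1 ht
  refine ⟨![a, b, c], fun i j hij => ?_, fun i => ?_⟩
  · fin_cases i <;> fin_cases j <;> simp_all
  · fin_cases i <;> exact hts (by simp)

section

variable {X : Type u} [TopologicalSpace X]

theorem encard_quotient_fiber_le {F G : Set C(X, ℝ)} (hFG : F ⊆ G)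
    (hF : ∀ x : Fin 3 → X, Function.Injective x → ¬ ∀ i j, FamilyEquiv F (x i) (x j))
    (y : Quotient (familySetoid G)) : (Quotient.mk (familySetoid G) ⁻¹' {y}).encard ≤ 2 := by
  by_contra h
  obtain ⟨x, hx, hxy⟩ := exists_injective_of_two_lt_encard h
  refine hF x hx fun i j => FamilyEquiv.mono hFG ?_
  have hq : Quotient.mk (familySetoid G) (x i) = Quotient.mk (familySetoid G) (x j) := by
    rw [show Quotient.mk _ (x i) = y from hxy i, show Quotient.mk _ (x j) = y from hxy j]
  exact Quotient.exact hq

/-- Evaluation is a continuous injection from a compact space into the Hausdorff space `ℝ^F`. For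
countable `F` this yields metrizability and countable weight. -/
theorem isClosedEmbedding_familyQuotient [CompactSpace X] (F : Set C(X, ℝ)) :
    Topology.IsClosedEmbedding (fun (q : Quotient (familySetoid F)) (f : F) =>
      Quotient.lift (fun x => f.1 x) (fun _ _ (h : FamilyEquiv F _ _) => h f.1 f.2) q) := by
  refine Continuous.isClosedEmbedding
    (continuous_pi fun f => Continuous.quotient_lift f.1.continuous _) ?_
  intro p q
  induction p using Quotient.inductionOn
  induction q using Quotient.inductionOn
  intro h
  exact Quotient.sound fun f hf => congrFun h ⟨f, hf⟩

theorem secondCountableTopology_modelQuotient {c : X → ZFSet.{u}} (hc : Function.Injective c)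
    {M : Set ZFSet.{u}} (hM : M.Countable) : SecondCountableTopology (ModelQuotient c M) := by
  refine ⟨_, ?_, rfl⟩
  have hinj : Function.Injective (subsetCode c) := fun U V h => by
    ext x
    have := congrArg (c x ∈ ·) h
    simpa [subsetCode, hc.eq_iff] using this
  refine ((hM.preimage hinj).image (fun U => modelProj c M '' U)).mono ?_
  rintro W ⟨U, -, hU, rfl⟩
  exact ⟨U, hU, rfl⟩

/-- The topology of `X/M` is the quotient topology provided that `M` contains enough functions for
its co-zero sets and conversely. -/
theorem modelQuotient_properties [CompactSpace X] {c : X → ZFSet.{u}} {M : Set ZFSet.{u}}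
    (h1 : ∀ U : Set X, IsCozero U → subsetCode c U ∈ M →
      ∃ f ∈ functionsIn c M, U = {x | f x ≠ 0})
    (h2 : ∀ f ∈ functionsIn c M, ∀ x y, f x < f y → ∃ U V : Set X, IsCozero U ∧ IsCozero V ∧
      subsetCode c U ∈ M ∧ subsetCode c V ∈ M ∧ x ∈ U ∧ y ∈ V ∧ Disjoint U V) :
    CompactSpace (ModelQuotient c M) ∧ T2Space (ModelQuotient c M) ∧
      Topology.IsQuotientMap (modelProj c M) := by
  have hsurj : Function.Surjective (modelProj c M) := Quotient.mk_surjective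
  -- By `h1` the set `U` is the co-zero set of a function in `M`, hence a union of classes.
  have hpre : ∀ U : Set X, IsCozero U → subsetCode c U ∈ M →
      modelProj c M ⁻¹' (modelProj c M '' U) = U := fun U hU hUM => by
    obtain ⟨f, hf, rfl⟩ := h1 U hU hUM
    refine Subset.antisymm ?_ (subset_preimage_image _ _)
    rintro x ⟨y, hy, hyx⟩
    exact isSaturated_of_mem hf y x (Quotient.exact hyx) hy
  have hcont : Continuous (modelProj c M) := by
    refine continuous_generateFrom_iff.2 ?_
    rintro W ⟨U, hU, hUM, rfl⟩
    rw [hpre U hU hUM]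
    obtain ⟨f, rfl⟩ := hU
    exact isOpen_ne_fun f.continuous continuous_const
  have hcomp : CompactSpace (ModelQuotient c M) := hsurj.compactSpace hcont
  have hsep : ∀ f ∈ functionsIn c M, ∀ x y, f x < f y → ∃ u v : Set (ModelQuotient c M),
      IsOpen u ∧ IsOpen v ∧ modelProj c M x ∈ u ∧ modelProj c M y ∈ v ∧ Disjoint u v := by
    intro f hf x y hxy
    obtain ⟨U, V, hU, hV, hUM, hVM, hx, hy, hUV⟩ := h2 f hf x y hxy
    refine ⟨_, _, isOpen_generateFrom_of_mem ⟨U, hU, hUM, rfl⟩,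
      isOpen_generateFrom_of_mem ⟨V, hV, hVM, rfl⟩, mem_image_of_mem _ hx,
      mem_image_of_mem _ hy, ?_⟩
    rw [disjoint_left]
    rintro _ ⟨a, ha, rfl⟩ hb
    exact disjoint_left.1 hUV ha ((hpre V hV hVM).subset hb)
  have ht2 : T2Space (ModelQuotient c M) := by
    refine ⟨fun p q hpq => ?_⟩
    obtain ⟨x, rfl⟩ := hsurj p
    obtain ⟨y, rfl⟩ := hsurj q
    have hne : ¬ FamilyEquiv (functionsIn c M) x y := fun h => hpq (Quotient.sound h)
    simp only [FamilyEquiv, not_forall] at hne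
    obtain ⟨f, hf, hne⟩ := hne
    rcases lt_or_gt_of_ne hne with h | h
    · exact hsep f hf x y h
    · obtain ⟨u, v, hu, hv, hyu, hxv, huv⟩ := hsep f hf y x h
      exact ⟨v, u, hv, hu, hxv, hyu, huv.symm⟩
  -- A continuous map from a compact space to a Hausdorff space is closed.
  exact ⟨hcomp, ht2, hcont.isClosedMap.isQuotientMap hcont hsurj⟩

end

end

section

open Set FirstOrder

/-! ### The sets `H(χ)` -/

theorem mem_HSet_of_mem {χ : Cardinal.{u}} {x y : ZFSet.{u}} (hx : x ∈ HSet χ) (hy : y ∈ x) :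
    y ∈ HSet χ :=
  ZFSet.Hereditarily.mem hx hy

theorem mem_HSet_of_subset {χ : Cardinal.{u}} {x y : ZFSet.{u}} (hx : x ∈ HSet χ) (hy : y ⊆ x) :
    y ∈ HSet χ :=
  ZFSet.hereditarily_iff.2
    ⟨(ZFSet.card_mono hy).trans_lt (ZFSet.Hereditarily.self hx),
      fun _ hz => mem_HSet_of_mem hx (hy hz)⟩

/-- Some level `V_o` of the cumulative hierarchy contains `x`. It is transitive, so its cardinality
bounds those of `x` and of everything hereditarily in `x`. -/
theorem exists_forall_mem_HSet (x : ZFSet.{u}) :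
    ∃ χ₀ : Cardinal.{u}, ∀ χ, χ₀ ≤ χ → x ∈ HSet χ := by
  obtain ⟨o, ho⟩ := ZFSet.exists_mem_vonNeumann x
  refine ⟨Order.succ (ZFSet.card (ZFSet.vonNeumann o)), fun χ hχ => ?_⟩
  have : ∀ y : ZFSet.{u}, y ∈ ZFSet.vonNeumann o → y ∈ HSet χ := fun y => by
    induction y using ZFSet.inductionOn with
    | h y ih =>
      intro hy
      have hsub : y ⊆ ZFSet.vonNeumann o := (ZFSet.isTransitive_vonNeumann o).subset_of_mem hy
      exact ZFSet.hereditarily_iff.2 ⟨(ZFSet.card_mono hsub).trans_lt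
        ((Order.lt_succ _).trans_le hχ), fun z hz => ih z hz (hsub hz)⟩
  exact this x ho

/-! ### Definable predicates -/

section

variable {χ : Cardinal.{u}}

/-- The predicate `P` on tuples from `H(χ)` is definable with parameters in `A`. -/
class Def (A : Set (HSet χ)) {α : Type} (P : (α → HSet χ) → Prop) : Prop where
  definable : A.Definable setLang {v | P v}

/-- `t` is a variable or a parameter from `A`. -/
class Tm (A : Set (HSet χ)) {α : Type} (t : (α → HSet χ) → ZFSet.{u}) : Prop where
  exists_term : ∃ t' : setLang[[A]].Term α, ∀ v, t v = (t'.realize v : HSet χ)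

variable {A : Set (HSet χ)} {α : Type} {P Q : (α → HSet χ) → Prop}
  {s t a b c : (α → HSet χ) → ZFSet.{u}}

instance Tm.var (i : α) : Tm A fun v : α → HSet χ => (v i : ZFSet.{u}) :=
  ⟨Language.Term.var i, fun _ => rfl⟩

instance Tm.const {x : ZFSet.{u}} [hx : Fact (x ∈ Subtype.val '' A)] :
    Tm A fun _ : α → HSet χ => x := by
  obtain ⟨a, ha, rfl⟩ := hx.out
  exact ⟨(setLang.con (⟨a, ha⟩ : A)).term, fun v => by simp⟩

theorem Tm.relabel (h : Tm A t) {β : Type} (f : α → β) :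
    Tm A fun w : β → HSet χ => t fun i => w (f i) := by
  obtain ⟨t', ht⟩ := h.exists_term
  exact ⟨t'.relabel f, fun w => by rw [ht, Language.Term.realize_relabel]; rfl⟩

theorem Def.congr (h : Def A P) (hPQ : ∀ v, Q v ↔ P v) : Def A Q := by
  rwa [show Q = P from funext fun v => propext (hPQ v)]

instance Def.not [h : Def A P] : Def A fun v => ¬ P v := ⟨h.definable.compl⟩

instance Def.and [h : Def A P] [h' : Def A Q] : Def A fun v => P v ∧ Q v :=
  ⟨h.definable.inter h'.definable⟩

instance Def.or [h : Def A P] [h' : Def A Q] : Def A fun v => P v ∨ Q v :=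
  ⟨h.definable.union h'.definable⟩

instance Def.imp [h : Def A P] [h' : Def A Q] : Def A fun v => P v → Q v :=
  (inferInstance : Def A fun v => ¬ P v ∨ Q v).congr fun _ => imp_iff_not_or

instance Def.iff [h : Def A P] [h' : Def A Q] : Def A fun v => (P v ↔ Q v) :=
  (inferInstance : Def A fun v => (P v → Q v) ∧ (Q v → P v)).congr
    fun _ => iff_iff_implies_and_implies

instance Def.eq [hs : Tm A s] [ht : Tm A t] : Def A fun v => s v = t v := by
  obtain ⟨s', hs⟩ := hs
  obtain ⟨t', ht⟩ := ht
  refine ⟨s'.equal t', ?_⟩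
  ext v
  simp [hs, ht, Subtype.ext_iff]

instance Def.mem [hs : Tm A s] [ht : Tm A t] : Def A fun v => s v ∈ t v := by
  obtain ⟨s', hs⟩ := hs
  obtain ⟨t', ht⟩ := ht
  let r : setLang[[A]].Relations 2 := Sum.inl SetRel.mem
  refine ⟨r.formula₂ s' t', ?_⟩
  ext v
  simp only [hs, ht, mem_ofPred_eq]
  exact Iff.symm (Language.Formula.realize_rel₂ (R := r) (t₁ := s') (t₂ := t') (v := v))

/-- The bound variable becomes the extra coordinate `.inr ()`. With these instances, instance search
proves definability by following the syntax of the predicate. -/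
instance Def.exH {P : (α → HSet χ) → ZFSet.{u} → Prop}
    [h : Def A fun w : α ⊕ Unit → HSet χ => P (fun i => w (.inl i)) (w (.inr ()))] :
    Def A fun v => ∃ z ∈ HSet χ, P v z := by
  refine Def.congr ⟨h.definable.exists_of_finite⟩ fun v => ?_
  constructor
  · rintro ⟨z, hz, hP⟩
    exact ⟨fun _ => ⟨z, hz⟩, hP⟩
  · rintro ⟨z, hP⟩
    exact ⟨z (), (z ()).2, hP⟩

instance Def.allH {P : (α → HSet χ) → ZFSet.{u} → Prop}
    [h : Def A fun w : α ⊕ Unit → HSet χ => P (fun i => w (.inl i)) (w (.inr ()))] :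
    Def A fun v => ∀ z ∈ HSet χ, P v z :=
  (Def.exH (P := fun v z => ¬ P v z) (h := Def.not)).not.congr fun v => by simp

/-- Because `H(χ)` is transitive, a bounded quantifier over sets has the same meaning inside `H(χ)`.
-/
instance Def.exMem {P : (α → HSet χ) → ZFSet.{u} → Prop} [ht : Tm A t]
    [h : Def A fun w : α ⊕ Unit → HSet χ => P (fun i => w (.inl i)) (w (.inr ()))] :
    Def A fun v => ∃ z ∈ t v, P v z := by
  have := ht.relabel (Sum.inl : α → α ⊕ Unit)
  refine (Def.exH (P := fun v z => z ∈ t v ∧ P v z) (h := Def.and)).congr fun v => ?_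
  obtain ⟨t', ht⟩ := ht.exists_term
  refine exists_congr fun z => ⟨fun h => ⟨?_, h⟩, fun h => h.2⟩
  rw [ht] at h
  exact mem_HSet_of_mem (t'.realize v).2 h.1

instance Def.allMem {P : (α → HSet χ) → ZFSet.{u} → Prop} [ht : Tm A t]
    [h : Def A fun w : α ⊕ Unit → HSet χ => P (fun i => w (.inl i)) (w (.inr ()))] :
    Def A fun v => ∀ z ∈ t v, P v z :=
  (Def.exMem (t := t) (P := fun v z => ¬ P v z) (h := Def.not)).not.congr fun v => by simp

instance Def.subset [Tm A s] [Tm A t] : Def A fun v => s v ⊆ t v := by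
  have := fun {β : Type} (f : α → β) => Tm.relabel ‹Tm A s› f
  have := fun {β : Type} (f : α → β) => Tm.relabel ‹Tm A t› f
  exact (inferInstance : Def A fun v => ∀ z ∈ s v, z ∈ t v).congr fun _ => ZFSet.subset_def

instance Def.eqEmpty [Tm A s] : Def A fun v => s v = ∅ :=
  (inferInstance : Def A fun v => ∀ z ∈ s v, ¬ z = z).congr fun _ => by
    simp [ZFSet.eq_empty]

instance Def.eqInsert [Tm A s] [Tm A t] [Tm A a] : Def A fun v => s v = insert (t v) (a v) := by
  have := fun {β : Type} (f : α → β) => Tm.relabel ‹Tm A s› f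
  have := fun {β : Type} (f : α → β) => Tm.relabel ‹Tm A t› f
  have := fun {β : Type} (f : α → β) => Tm.relabel ‹Tm A a› f
  exact (inferInstance : Def A fun v => (t v ∈ s v ∧ ∀ z ∈ a v, z ∈ s v) ∧
    ∀ z ∈ s v, z = t v ∨ z ∈ a v).congr fun v => by
      constructor
      · intro h
        rw [h]
        simp +contextual
      · rintro ⟨⟨h1, h2⟩, h3⟩
        ext z
        rw [ZFSet.mem_insert_iff]
        exact ⟨h3 z, fun h => h.elim (fun h => h ▸ h1) (h2 z)⟩

instance Def.eqSingleton [Tm A s] [Tm A t] : Def A fun v => s v = {t v} := by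
  have := fun {β : Type} (f : α → β) => Tm.relabel ‹Tm A s› f
  have := fun {β : Type} (f : α → β) => Tm.relabel ‹Tm A t› f
  exact (inferInstance : Def A fun v => t v ∈ s v ∧ ∀ z ∈ s v, z = t v).congr fun v => by
      constructor
      · intro h
        rw [h]
        simp
      · rintro ⟨h1, h2⟩
        ext z
        rw [ZFSet.mem_singleton]
        exact ⟨h2 z, fun h => h ▸ h1⟩

instance Def.eqUnordered [Tm A s] [Tm A a] [Tm A b] : Def A fun v => s v = {a v, b v} := by
  have := fun {β : Type} (f : α → β) => Tm.relabel ‹Tm A s› f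
  have := fun {β : Type} (f : α → β) => Tm.relabel ‹Tm A a› f
  have := fun {β : Type} (f : α → β) => Tm.relabel ‹Tm A b› f
  exact (inferInstance : Def A fun v => (a v ∈ s v ∧ b v ∈ s v) ∧ ∀ z ∈ s v, z = a v ∨ z = b v).congr
    fun v => by
      constructor
      · intro h
        rw [h]
        simp
      · rintro ⟨⟨h1, h2⟩, h3⟩
        ext z
        rw [ZFSet.mem_pair]
        exact ⟨h3 z, fun h => h.elim (fun h => h ▸ h1) (fun h => h ▸ h2)⟩

instance Def.eqPair [Tm A s] [Tm A a] [Tm A b] : Def A fun v => s v = ZFSet.pair (a v) (b v) := by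
  have := fun {β : Type} (f : α → β) => Tm.relabel ‹Tm A s› f
  have := fun {β : Type} (f : α → β) => Tm.relabel ‹Tm A a› f
  have := fun {β : Type} (f : α → β) => Tm.relabel ‹Tm A b› f
  refine (inferInstance : Def A fun v => ((∃ z ∈ s v, z = {a v}) ∧ ∃ z ∈ s v, z = {a v, b v}) ∧
    ∀ z ∈ s v, z = {a v} ∨ z = {a v, b v}).congr fun v => ?_
  constructor
  · intro h
    rw [h]
    simp [ZFSet.pair]
  · rintro ⟨⟨⟨_, h1, rfl⟩, _, h2, rfl⟩, h3⟩
    ext z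
    rw [ZFSet.pair, ZFSet.mem_pair]
    exact ⟨h3 z, fun h => h.elim (fun h => h ▸ h1) (fun h => h ▸ h2)⟩

instance Def.eqTriple [Tm A s] [Tm A a] [Tm A b] [Tm A c] :
    Def A fun v => s v = ZFSet.pair (a v) (ZFSet.pair (b v) (c v)) := by
  have := fun {β : Type} (f : α → β) => Tm.relabel ‹Tm A s› f
  have := fun {β : Type} (f : α → β) => Tm.relabel ‹Tm A a› f
  have := fun {β : Type} (f : α → β) => Tm.relabel ‹Tm A b› f
  have := fun {β : Type} (f : α → β) => Tm.relabel ‹Tm A c› f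
  -- The inner pair is not a variable or parameter, so it is named by `z`, found as an element of an
  -- element of the Kuratowski pair.
  refine (inferInstance : Def A fun v => ∃ u ∈ s v, ∃ z ∈ u, s v = ZFSet.pair (a v) z ∧
    z = ZFSet.pair (b v) (c v)).congr fun v => ?_
  constructor
  · intro h
    exact ⟨{a v, ZFSet.pair (b v) (c v)}, by rw [h]; simp [ZFSet.pair], _, by simp, h, rfl⟩
  · rintro ⟨-, -, z, -, h, rfl⟩
    exact h

theorem Def.memOfEq {p : (α → HSet χ) → ZFSet.{u}} [ht : Tm A t]
    (h : Def A fun w : α ⊕ Unit → HSet χ => (w (.inr ()) : ZFSet.{u}) = p fun i => w (.inl i)) :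
    Def A fun v => p v ∈ t v :=
  (Def.exMem (t := t) (P := fun v z => z = p v)).congr fun v => by simp

instance Def.pairMem [Tm A t] [Tm A a] [Tm A b] : Def A fun v => ZFSet.pair (a v) (b v) ∈ t v := by
  have := fun {β : Type} (f : α → β) => Tm.relabel ‹Tm A a› f
  have := fun {β : Type} (f : α → β) => Tm.relabel ‹Tm A b› f
  exact Def.memOfEq inferInstance

instance Def.tripleMem [Tm A t] [Tm A a] [Tm A b] [Tm A c] :
    Def A fun v => ZFSet.pair (a v) (ZFSet.pair (b v) (c v)) ∈ t v := by
  have := fun {β : Type} (f : α → β) => Tm.relabel ‹Tm A a› f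
  have := fun {β : Type} (f : α → β) => Tm.relabel ‹Tm A b› f
  have := fun {β : Type} (f : α → β) => Tm.relabel ‹Tm A c› f
  exact Def.memOfEq inferInstance

instance Def.insertMem [Tm A t] [Tm A a] [Tm A b] : Def A fun v => insert (a v) (b v) ∈ t v := by
  have := fun {β : Type} (f : α → β) => Tm.relabel ‹Tm A a› f
  have := fun {β : Type} (f : α → β) => Tm.relabel ‹Tm A b› f
  exact Def.memOfEq inferInstance

theorem exists_mem_of_def {S : setLang.ElementarySubstructure (HSet χ)} {P : ZFSet.{u} → Prop}
    (h : Def (S : Set (HSet χ)) fun v : Fin 1 → HSet χ => P (v 0)) {x : ZFSet.{u}}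
    (hx : x ∈ HSet χ) (hPx : P x) : ∃ y ∈ Subtype.val '' (S : Set (HSet χ)), P y := by
  obtain ⟨y, hy, hyS⟩ := S.meetsDefinable {y | P y} ⟨⟨x, hx⟩, hPx⟩ h.definable
  exact ⟨y, mem_image_of_mem _ hyS, hy⟩

/-- The Tarski–Vaught property puts some witness in the submodel, and uniqueness identifies it with
`x`. -/
theorem mem_of_def {S : setLang.ElementarySubstructure (HSet χ)} {P : ZFSet.{u} → Prop}
    (h : Def (S : Set (HSet χ)) fun v : Fin 1 → HSet χ => P (v 0)) {x : ZFSet.{u}}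
    (hx : x ∈ HSet χ) (hPx : P x) (huniq : ∀ y ∈ HSet χ, P y → y = x) :
    x ∈ Subtype.val '' (S : Set (HSet χ)) := by
  obtain ⟨y, hy, hPy⟩ := exists_mem_of_def h hx hPx
  obtain ⟨z, -, rfl⟩ := id hy
  rwa [← huniq z z.2 hPy]

end

end

section

open Set FirstOrder

/-! ### Natural numbers -/

theorem natCode_mem_natCode {m n : ℕ} : natCode.{u} m ∈ natCode.{u} n ↔ m < n := by
  have h1 : ∀ {m n : ℕ}, m < n → natCode.{u} m ∈ natCode.{u} n := fun {m n} h => by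
    induction n with
    | zero => omega
    | succ n ih =>
      rw [natCode, ZFSet.mem_insert_iff]
      rcases Nat.lt_succ_iff_lt_or_eq.1 h with h | h
      exacts [Or.inr (ih h), Or.inl (by rw [h])]
  refine ⟨fun h => ?_, h1⟩
  by_contra hmn
  rcases (not_lt.1 hmn).lt_or_eq with h' | h'
  · exact ZFSet.mem_asymm h (h1 h')
  · exact ZFSet.mem_irrefl _ (h' ▸ h)

theorem natCode_injective : Function.Injective natCode.{u} := fun m n h => by
  rcases lt_trichotomy m n with h' | h' | h'
  · exact absurd (h ▸ natCode_mem_natCode.2 h') (ZFSet.mem_irrefl _)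
  · exact h'
  · exact absurd (h ▸ natCode_mem_natCode.2 h') (ZFSet.mem_irrefl _)

theorem natCode_inj {m n : ℕ} : natCode.{u} m = natCode n ↔ m = n := natCode_injective.eq_iff

theorem natCode_succ (n : ℕ) : natCode.{u} (n + 1) = insert (natCode n) (natCode n) := rfl

/-- The set of natural numbers. -/
noncomputable def omegaCode : ZFSet.{u} := ZFSet.range natCode.{u}

theorem mem_omegaCode {x : ZFSet.{u}} : x ∈ omegaCode ↔ ∃ n, natCode n = x := ZFSet.mem_range

theorem natCode_mem_omegaCode (n : ℕ) : natCode.{u} n ∈ omegaCode := mem_omegaCode.2 ⟨n, rfl⟩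

theorem forall_mem_omegaCode {P : ZFSet.{u} → Prop} :
    (∀ x ∈ omegaCode, P x) ↔ ∀ n, P (natCode n) :=
  ⟨fun h n => h _ (natCode_mem_omegaCode n), fun h x hx => by
    obtain ⟨n, rfl⟩ := mem_omegaCode.1 hx
    exact h n⟩

theorem exists_mem_omegaCode {P : ZFSet.{u} → Prop} :
    (∃ x ∈ omegaCode, P x) ↔ ∃ n, P (natCode n) :=
  ⟨fun ⟨x, hx, h⟩ => by
    obtain ⟨n, rfl⟩ := mem_omegaCode.1 hx
    exact ⟨n, h⟩, fun ⟨n, h⟩ => ⟨_, natCode_mem_omegaCode n, h⟩⟩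

/-- By `∈`-induction every member is reached from `∅` by successors, so bounded conditions suffice
to define `ω`. -/
theorem eq_omegaCode {w : ZFSet.{u}} (h0 : ∅ ∈ w) (h1 : ∀ n ∈ w, insert n n ∈ w)
    (h2 : ∀ n ∈ w, n = ∅ ∨ ∃ m ∈ w, n = insert m m) : w = omegaCode := by
  ext x
  constructor
  · induction x using ZFSet.inductionOn with
    | h x ih =>
      intro hx
      rcases h2 x hx with rfl | ⟨m, hm, rfl⟩
      · exact natCode_mem_omegaCode 0
      · obtain ⟨n, rfl⟩ := mem_omegaCode.1 (ih m (ZFSet.mem_insert _ _) hm)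
        exact natCode_mem_omegaCode (n + 1)
  · intro hx
    obtain ⟨n, rfl⟩ := mem_omegaCode.1 hx
    induction n with
    | zero => exact h0
    | succ n ih => exact h1 _ (ih (natCode_mem_omegaCode n))

/-- The triple of natural numbers `t` as a set. -/
noncomputable def tripleCode (t : ℕ × ℕ × ℕ) : ZFSet.{u} :=
  ZFSet.pair (natCode t.1) (ZFSet.pair (natCode t.2.1) (natCode t.2.2))

theorem tripleCode_injective : Function.Injective tripleCode.{u} := by
  rintro ⟨a, b, d⟩ ⟨a', b', d'⟩ h
  simpa [tripleCode, ZFSet.pair_inj, natCode_inj] using h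

theorem tripleCode_inj {t t' : ℕ × ℕ × ℕ} : tripleCode.{u} t = tripleCode t' ↔ t = t' :=
  tripleCode_injective.eq_iff

/-- A set of triples of natural numbers as a set. -/
noncomputable def tripleSetCode (s : Set (ℕ × ℕ × ℕ)) : ZFSet.{u} :=
  ZFSet.range fun t : s => tripleCode.{u} t.1

theorem mem_tripleSetCode {s : Set (ℕ × ℕ × ℕ)} {x : ZFSet.{u}} :
    x ∈ tripleSetCode s ↔ ∃ t ∈ s, tripleCode t = x := by
  simp [tripleSetCode]

theorem tripleCode_mem_tripleSetCode {s : Set (ℕ × ℕ × ℕ)} {t : ℕ × ℕ × ℕ} :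
    tripleCode.{u} t ∈ tripleSetCode.{u} s ↔ t ∈ s := by
  simp [mem_tripleSetCode, tripleCode_inj]

theorem eq_tripleSetCode {s : Set (ℕ × ℕ × ℕ)} {y : ZFSet.{u}}
    (h : ∀ z ∈ y, ∃ t, z = tripleCode t) (h' : ∀ t, tripleCode t ∈ y ↔ t ∈ s) :
    y = tripleSetCode s := by
  ext z
  rw [mem_tripleSetCode]
  constructor
  · intro hz
    obtain ⟨t, rfl⟩ := h z hz
    exact ⟨t, (h' t).1 hz, rfl⟩
  · rintro ⟨t, ht, rfl⟩
    exact (h' t).2 ht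

/-- The graph of addition. -/
def addGraph : Set (ℕ × ℕ × ℕ) := {t | t.1 + t.2.1 = t.2.2}

/-- The graph of multiplication. -/
def mulGraph : Set (ℕ × ℕ × ℕ) := {t | t.1 * t.2.1 = t.2.2}

/-- The rational number represented by a triple. -/
noncomputable def tripleVal (t : ℕ × ℕ × ℕ) : ℝ := ((t.1 : ℝ) - t.2.1) / (t.2.2 + 1)

/-- The order of the rational numbers, on triples. -/
noncomputable def ltCode : ZFSet.{u} :=
  ZFSet.range fun p : {p : (ℕ × ℕ × ℕ) × (ℕ × ℕ × ℕ) // tripleVal p.1 < tripleVal p.2} =>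
    ZFSet.pair (tripleCode.{u} p.1.1) (tripleCode.{u} p.1.2)

/-- The set of real numbers. -/
noncomputable def realSetCode : ZFSet.{u} := ZFSet.range realCode.{u}

section

variable {χ : Cardinal.{u}} {S : setLang.ElementarySubstructure (HSet χ)}

local notation "MM" => Subtype.val '' (S : Set (HSet χ))

theorem omegaCode_mem (h : omegaCode ∈ HSet χ) : omegaCode ∈ MM := by
  refine mem_of_def (P := fun w => (∃ z ∈ w, z = ∅) ∧ (∀ n ∈ w, insert n n ∈ w) ∧
    ∀ n ∈ w, n = ∅ ∨ ∃ m ∈ w, n = insert m m) inferInstance h ?_ ?_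
  · simp only [forall_mem_omegaCode, exists_mem_omegaCode]
    refine ⟨⟨0, rfl⟩, fun n => natCode_mem_omegaCode (n + 1), fun n => ?_⟩
    cases n with
    | zero => exact Or.inl rfl
    | succ n => exact Or.inr ⟨n, rfl⟩
  · rintro w - ⟨⟨_, h0, rfl⟩, h1, h2⟩
    exact eq_omegaCode h0 h1 h2

theorem natCode_mem (h : omegaCode ∈ HSet χ) (n : ℕ) : natCode n ∈ MM := by
  induction n with
  | zero =>
    exact mem_of_def (P := fun w => w = ∅) inferInstance
      (mem_HSet_of_mem h (natCode_mem_omegaCode 0)) rfl fun y _ hy => hy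
  | succ n ih =>
    have : Fact (natCode n ∈ MM) := ⟨ih⟩
    exact mem_of_def (P := fun w => w = insert (natCode n) (natCode n)) inferInstance
      (mem_HSet_of_mem h (natCode_mem_omegaCode (n + 1))) rfl fun y _ hy => hy

theorem addGraph_mem (hω : omegaCode ∈ HSet χ) (h : tripleSetCode addGraph ∈ HSet χ) :
    tripleSetCode addGraph ∈ MM := by
  have : Fact (omegaCode ∈ MM) := ⟨omegaCode_mem hω⟩
  -- The recursion equations of addition determine its graph. The successor is named by the variable
  -- `n'`, since entries of a triple must be variables or parameters.
  refine mem_of_def (P := fun A =>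
    (∀ z ∈ A, ∃ m ∈ omegaCode, ∃ n ∈ omegaCode, ∃ k ∈ omegaCode,
      z = ZFSet.pair m (ZFSet.pair n k)) ∧
    ∀ m ∈ omegaCode, ∀ n ∈ omegaCode, ∀ k ∈ omegaCode,
      (n = ∅ → (ZFSet.pair m (ZFSet.pair n k) ∈ A ↔ k = m)) ∧
      ∀ n' ∈ omegaCode, n' = insert n n → (ZFSet.pair m (ZFSet.pair n' k) ∈ A ↔
        ∃ l ∈ omegaCode, k = insert l l ∧ ZFSet.pair m (ZFSet.pair n l) ∈ A)) inferInstance h ?_ ?_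
  · simp only [forall_mem_omegaCode, exists_mem_omegaCode]
    refine ⟨fun z hz => ?_, fun m n k => ⟨fun hn => ?_, fun n' hn' => ?_⟩⟩
    · obtain ⟨⟨m, n, k⟩, -, rfl⟩ := mem_tripleSetCode.1 hz
      exact ⟨m, n, k, rfl⟩
    · obtain rfl : n = 0 := natCode_injective hn
      refine (tripleCode_mem_tripleSetCode (t := (m, 0, k))).trans ?_
      rw [natCode_inj]
      simp [addGraph, eq_comm]
    · obtain rfl : n' = n + 1 := natCode_injective hn'
      refine (tripleCode_mem_tripleSetCode (t := (m, n + 1, k))).trans ?_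
      simp only [← natCode_succ, natCode_inj]
      constructor
      · intro h
        exact ⟨m + n, by simpa [addGraph, add_assoc, eq_comm] using h,
          (tripleCode_mem_tripleSetCode (t := (m, n, m + n))).2 rfl⟩
      · rintro ⟨l, rfl, hl⟩
        have hl : m + n = l := (tripleCode_mem_tripleSetCode (t := (m, n, l))).1 hl
        simp [addGraph, ← hl, add_assoc]
  · simp only [forall_mem_omegaCode, exists_mem_omegaCode]
    rintro y - ⟨h1, h2⟩
    refine eq_tripleSetCode (fun z hz => ?_) ?_
    · obtain ⟨m, n, k, hz⟩ := h1 z hz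
      exact ⟨(m, n, k), hz⟩
    · rintro ⟨m, n, k⟩
      simp only [addGraph, mem_ofPred_eq, tripleCode]
      induction n generalizing k with
      | zero => rw [(h2 m 0 k).1 rfl, natCode_inj, add_zero, eq_comm]
      | succ n ih =>
        rw [(h2 m n k).2 (n + 1) rfl]
        simp only [ih, ← natCode_succ, natCode_inj]
        constructor
        · rintro ⟨l, rfl, rfl⟩
          rfl
        · rintro rfl
          exact ⟨m + n, rfl, rfl⟩

theorem mulGraph_mem (hω : omegaCode ∈ HSet χ) (ha : tripleSetCode addGraph ∈ HSet χ)
    (h : tripleSetCode mulGraph ∈ HSet χ) : tripleSetCode mulGraph ∈ MM := by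
  have : Fact (omegaCode ∈ MM) := ⟨omegaCode_mem hω⟩
  have : Fact (tripleSetCode addGraph ∈ MM) := ⟨addGraph_mem hω ha⟩
  have hadd : ∀ a b c : ℕ, ZFSet.pair (natCode.{u} a) (ZFSet.pair (natCode b) (natCode c)) ∈
      tripleSetCode addGraph ↔ a + b = c := fun a b c =>
    tripleCode_mem_tripleSetCode (t := (a, b, c))
  refine mem_of_def (P := fun A =>
    (∀ z ∈ A, ∃ m ∈ omegaCode, ∃ n ∈ omegaCode, ∃ k ∈ omegaCode,
      z = ZFSet.pair m (ZFSet.pair n k)) ∧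
    ∀ m ∈ omegaCode, ∀ n ∈ omegaCode, ∀ k ∈ omegaCode,
      (n = ∅ → (ZFSet.pair m (ZFSet.pair n k) ∈ A ↔ k = ∅)) ∧
      ∀ n' ∈ omegaCode, n' = insert n n → (ZFSet.pair m (ZFSet.pair n' k) ∈ A ↔
        ∃ l ∈ omegaCode, ZFSet.pair l (ZFSet.pair m k) ∈ tripleSetCode addGraph ∧
          ZFSet.pair m (ZFSet.pair n l) ∈ A)) inferInstance h ?_ ?_
  · simp only [forall_mem_omegaCode, exists_mem_omegaCode, hadd]
    refine ⟨fun z hz => ?_, fun m n k => ⟨fun hn => ?_, fun n' hn' => ?_⟩⟩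
    · obtain ⟨⟨m, n, k⟩, -, rfl⟩ := mem_tripleSetCode.1 hz
      exact ⟨m, n, k, rfl⟩
    · obtain rfl : n = 0 := natCode_injective hn
      refine (tripleCode_mem_tripleSetCode (t := (m, 0, k))).trans ?_
      rw [show (∅ : ZFSet.{u}) = natCode 0 from rfl, natCode_inj]
      simp [mulGraph, eq_comm]
    · obtain rfl : n' = n + 1 := natCode_injective hn'
      refine (tripleCode_mem_tripleSetCode (t := (m, n + 1, k))).trans ?_
      constructor
      · intro h
        exact ⟨m * n, by simpa [mulGraph, mul_add] using h,
          (tripleCode_mem_tripleSetCode (t := (m, n, m * n))).2 rfl⟩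
      · rintro ⟨l, rfl, hl⟩
        have hl : m * n = l := (tripleCode_mem_tripleSetCode (t := (m, n, l))).1 hl
        simp [mulGraph, ← hl, mul_add]
  · simp only [forall_mem_omegaCode, exists_mem_omegaCode, hadd]
    rintro y - ⟨h1, h2⟩
    refine eq_tripleSetCode (fun z hz => ?_) ?_
    · obtain ⟨m, n, k, hz⟩ := h1 z hz
      exact ⟨(m, n, k), hz⟩
    · rintro ⟨m, n, k⟩
      simp only [mulGraph, mem_ofPred_eq, tripleCode]
      induction n generalizing k with
      | zero =>
        rw [(h2 m 0 k).1 rfl, show (∅ : ZFSet.{u}) = natCode 0 from rfl, natCode_inj, mul_zero,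
          eq_comm]
      | succ n ih =>
        rw [(h2 m n k).2 (n + 1) rfl]
        simp only [ih]
        constructor
        · rintro ⟨l, rfl, rfl⟩
          rfl
        · rintro rfl
          exact ⟨m * n, rfl, rfl⟩

theorem tripleSetCode_univ_mem (hω : omegaCode ∈ HSet χ) (h : tripleSetCode univ ∈ HSet χ) :
    tripleSetCode univ ∈ MM := by
  have : Fact (omegaCode ∈ MM) := ⟨omegaCode_mem hω⟩
  refine mem_of_def (P := fun A =>
    (∀ z ∈ A, ∃ m ∈ omegaCode, ∃ n ∈ omegaCode, ∃ k ∈ omegaCode,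
      z = ZFSet.pair m (ZFSet.pair n k)) ∧
    ∀ m ∈ omegaCode, ∀ n ∈ omegaCode, ∀ k ∈ omegaCode, ZFSet.pair m (ZFSet.pair n k) ∈ A)
    inferInstance h ?_ ?_
  · simp only [forall_mem_omegaCode, exists_mem_omegaCode]
    refine ⟨fun z hz => ?_, fun m n k =>
      (tripleCode_mem_tripleSetCode (t := (m, n, k))).2 (mem_univ _)⟩
    obtain ⟨⟨m, n, k⟩, -, rfl⟩ := mem_tripleSetCode.1 hz
    exact ⟨m, n, k, rfl⟩
  · simp only [forall_mem_omegaCode, exists_mem_omegaCode]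
    rintro y - ⟨h1, h2⟩
    refine eq_tripleSetCode (fun z hz => ?_) fun t => iff_of_true (h2 _ _ _) (mem_univ _)
    obtain ⟨m, n, k, hz⟩ := h1 z hz
    exact ⟨(m, n, k), hz⟩

/-- The order of triples expressed by addition and multiplication. -/
abbrev TripleLT (t t' : ZFSet.{u}) : Prop :=
  ∃ a ∈ omegaCode, ∃ b ∈ omegaCode, ∃ d ∈ omegaCode, ∃ a' ∈ omegaCode, ∃ b' ∈ omegaCode,
  ∃ d' ∈ omegaCode, t = ZFSet.pair a (ZFSet.pair b d) ∧ t' = ZFSet.pair a' (ZFSet.pair b' d') ∧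
  ∃ e ∈ omegaCode, ∃ e' ∈ omegaCode, e = insert d d ∧ e' = insert d' d' ∧
  ∃ p ∈ omegaCode, ∃ q ∈ omegaCode, ∃ p' ∈ omegaCode, ∃ q' ∈ omegaCode,
    ZFSet.pair a (ZFSet.pair e' p) ∈ tripleSetCode mulGraph ∧
    ZFSet.pair b' (ZFSet.pair e q) ∈ tripleSetCode mulGraph ∧
    ZFSet.pair a' (ZFSet.pair e p') ∈ tripleSetCode mulGraph ∧
    ZFSet.pair b (ZFSet.pair e' q') ∈ tripleSetCode mulGraph ∧
    ∃ s ∈ omegaCode, ∃ s' ∈ omegaCode, ZFSet.pair p (ZFSet.pair q s) ∈ tripleSetCode addGraph ∧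
      ZFSet.pair p' (ZFSet.pair q' s') ∈ tripleSetCode addGraph ∧ s ∈ s'

theorem tripleVal_lt_iff (t t' : ℕ × ℕ × ℕ) : tripleVal t < tripleVal t' ↔
    t.1 * (t'.2.2 + 1) + t'.2.1 * (t.2.2 + 1) < t'.1 * (t.2.2 + 1) + t.2.1 * (t'.2.2 + 1) := by
  rw [tripleVal, tripleVal, div_lt_div_iff₀ (by positivity) (by positivity),
    ← Nat.cast_lt (α := ℝ)]
  push_cast
  constructor <;> intro h <;> linarith

theorem tripleLT_iff (t t' : ℕ × ℕ × ℕ) :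
    TripleLT (tripleCode.{u} t) (tripleCode t') ↔ tripleVal t < tripleVal t' := by
  have hc : ∀ (s : Set (ℕ × ℕ × ℕ)) (a b c : ℕ), ZFSet.pair (natCode.{u} a)
      (ZFSet.pair (natCode b) (natCode c)) ∈ tripleSetCode s ↔ (a, b, c) ∈ s := fun s a b c =>
    tripleCode_mem_tripleSetCode (t := (a, b, c))
  obtain ⟨a, b, d⟩ := t
  obtain ⟨a', b', d'⟩ := t'
  simp only [TripleLT, exists_mem_omegaCode, hc, ← natCode_succ, natCode_inj, tripleCode,
    ZFSet.pair_inj, tripleVal_lt_iff, natCode_mem_natCode, mulGraph, addGraph, mem_ofPred_eq]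
  constructor
  · rintro ⟨_, _, _, _, _, _, ⟨rfl, rfl, rfl⟩, ⟨rfl, rfl, rfl⟩, _, _, rfl, rfl, _, _, _, _, rfl, rfl,
      rfl, rfl, _, _, rfl, rfl, h⟩
    exact h
  · intro h
    exact ⟨_, _, _, _, _, _, ⟨rfl, rfl, rfl⟩, ⟨rfl, rfl, rfl⟩, _, _, rfl, rfl, _, _, _, _, rfl, rfl,
      rfl, rfl, _, _, rfl, rfl, h⟩

theorem pair_mem_ltCode {t t' : ℕ × ℕ × ℕ} :
    ZFSet.pair (tripleCode.{u} t) (tripleCode t') ∈ ltCode.{u} ↔ tripleVal t < tripleVal t' := by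
  simp [ltCode, ZFSet.pair_inj, tripleCode_inj]

set_option synthInstance.maxHeartbeats 200000 in
set_option synthInstance.maxSize 2048 in
theorem ltCode_mem (hω : omegaCode ∈ HSet χ) (ha : tripleSetCode addGraph ∈ HSet χ)
    (hm : tripleSetCode mulGraph ∈ HSet χ) (hT : tripleSetCode univ ∈ HSet χ)
    (h : ltCode ∈ HSet χ) : ltCode ∈ MM := by
  have : Fact (omegaCode ∈ MM) := ⟨omegaCode_mem hω⟩
  have : Fact (tripleSetCode addGraph ∈ MM) := ⟨addGraph_mem hω ha⟩
  have : Fact (tripleSetCode mulGraph ∈ MM) := ⟨mulGraph_mem hω ha hm⟩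
  have : Fact (tripleSetCode univ ∈ MM) := ⟨tripleSetCode_univ_mem hω hT⟩
  have hTm : ∀ t, tripleCode t ∈ tripleSetCode univ := fun t =>
    tripleCode_mem_tripleSetCode.2 (mem_univ _)
  refine mem_of_def (P := fun L =>
    (∀ z ∈ L, ∃ t ∈ tripleSetCode univ, ∃ t' ∈ tripleSetCode univ, z = ZFSet.pair t t') ∧
    ∀ t ∈ tripleSetCode univ, ∀ t' ∈ tripleSetCode univ,
      (ZFSet.pair t t' ∈ L ↔ TripleLT t t')) inferInstance h ?_ ?_
  · refine ⟨fun z hz => ?_, fun t ht t' ht' => ?_⟩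
    · obtain ⟨p, rfl⟩ := ZFSet.mem_range.1 hz
      exact ⟨_, hTm _, _, hTm _, rfl⟩
    · obtain ⟨t, -, rfl⟩ := mem_tripleSetCode.1 ht
      obtain ⟨t', -, rfl⟩ := mem_tripleSetCode.1 ht'
      rw [pair_mem_ltCode, tripleLT_iff]
  · rintro y - ⟨h1, h2⟩
    have h3 : ∀ t t', ZFSet.pair (tripleCode t) (tripleCode t') ∈ y ↔
        ZFSet.pair (tripleCode t) (tripleCode t') ∈ ltCode := fun t t' => by
      rw [h2 _ (hTm t) _ (hTm t'), tripleLT_iff, pair_mem_ltCode]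
    ext z
    constructor
    · intro hz
      obtain ⟨t, ht, t', ht', rfl⟩ := h1 z hz
      obtain ⟨t, -, rfl⟩ := mem_tripleSetCode.1 ht
      obtain ⟨t', -, rfl⟩ := mem_tripleSetCode.1 ht'
      exact (h3 t t').1 hz
    · intro hz
      obtain ⟨p, rfl⟩ := ZFSet.mem_range.1 hz
      exact (h3 _ _).2 hz

end

end

/-! ### Real numbers as Dedekind cuts -/

section

open Set FirstOrder

theorem mem_realCode {x : ℝ} {z : ZFSet.{u}} :
    z ∈ realCode x ↔ ∃ t, tripleVal t < x ∧ tripleCode t = z := by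
  simp only [realCode, ZFSet.mem_range, Subtype.exists]
  exact exists_congr fun t => ⟨fun ⟨h, h'⟩ => ⟨h, h'⟩, fun ⟨h, h'⟩ => ⟨h, h'⟩⟩

theorem tripleCode_mem_realCode {x : ℝ} {t : ℕ × ℕ × ℕ} :
    tripleCode.{u} t ∈ realCode.{u} x ↔ tripleVal t < x := by
  simp [mem_realCode, tripleCode_inj]

theorem exists_tripleVal_eq (q : ℚ) : ∃ t, tripleVal t = q := by
  refine ⟨(q.num.toNat, (-q.num).toNat, q.den - 1), ?_⟩
  have h1 : ((q.num.toNat : ℤ) : ℝ) - (((-q.num).toNat : ℤ) : ℝ) = (q.num : ℝ) := by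
    rw [← Int.cast_sub]
    congr 1
    omega
  have h2 : ((q.den - 1 : ℕ) : ℝ) + 1 = q.den := by
    have := q.den_pos
    rw [← Nat.cast_add_one]
    congr 1
    omega
  simp only [Int.cast_natCast] at h1
  rw [tripleVal, h1, h2, Rat.cast_def]

theorem exists_tripleVal_btwn {x y : ℝ} (h : x < y) : ∃ t, x < tripleVal t ∧ tripleVal t < y := by
  obtain ⟨q, hq⟩ := exists_rat_btwn h
  obtain ⟨t, ht⟩ := exists_tripleVal_eq q
  exact ⟨t, by rwa [ht]⟩

theorem realCode_subset_iff {x y : ℝ} : realCode.{u} x ⊆ realCode.{u} y ↔ x ≤ y := by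
  constructor
  · intro h
    by_contra hxy
    obtain ⟨t, h1, h2⟩ := exists_tripleVal_btwn (not_le.1 hxy)
    exact absurd (tripleCode_mem_realCode.1 (h (tripleCode_mem_realCode.2 h2))) h1.not_gt
  · intro h z hz
    obtain ⟨t, ht, rfl⟩ := mem_realCode.1 hz
    exact tripleCode_mem_realCode.2 (ht.trans_le h)

theorem realCode_injective : Function.Injective realCode.{u} := fun _ _ h =>
  le_antisymm (realCode_subset_iff.1 (h ▸ fun _ => id)) (realCode_subset_iff.1 (h ▸ fun _ => id))

theorem realCode_inj {x y : ℝ} : realCode.{u} x = realCode.{u} y ↔ x = y :=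
  realCode_injective.eq_iff

theorem mem_realSetCode {x : ZFSet.{u}} : x ∈ realSetCode ↔ ∃ r, realCode r = x := ZFSet.mem_range

theorem realCode_mem_realSetCode (r : ℝ) : realCode.{u} r ∈ realSetCode :=
  mem_realSetCode.2 ⟨r, rfl⟩

theorem forall_mem_realSetCode {P : ZFSet.{u} → Prop} :
    (∀ x ∈ realSetCode, P x) ↔ ∀ r, P (realCode r) :=
  ⟨fun h n => h _ (realCode_mem_realSetCode n), fun h x hx => by
    obtain ⟨n, rfl⟩ := mem_realSetCode.1 hx
    exact h n⟩

theorem exists_mem_realSetCode {P : ZFSet.{u} → Prop} :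
    (∃ x ∈ realSetCode, P x) ↔ ∃ r, P (realCode r) :=
  ⟨fun ⟨x, hx, h⟩ => by
    obtain ⟨n, rfl⟩ := mem_realSetCode.1 hx
    exact ⟨n, h⟩, fun ⟨n, h⟩ => ⟨_, realCode_mem_realSetCode n, h⟩⟩

/-- `r` is a Dedekind cut. -/
abbrev IsCut (r : ZFSet.{u}) : Prop :=
  (∀ t ∈ r, t ∈ tripleSetCode univ) ∧ (∃ t ∈ tripleSetCode univ, t ∈ r) ∧
  (∃ t ∈ tripleSetCode univ, t ∉ r) ∧
  (∀ t ∈ r, ∀ t' ∈ tripleSetCode univ, ZFSet.pair t' t ∈ ltCode → t' ∈ r) ∧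
  ∀ t ∈ r, ∃ t' ∈ r, ZFSet.pair t t' ∈ ltCode

theorem isCut_iff {r : ZFSet.{u}} : IsCut r ↔ r ∈ realSetCode := by
  have hT : ∀ t, tripleCode t ∈ tripleSetCode univ := fun t =>
    tripleCode_mem_tripleSetCode.2 (mem_univ _)
  rw [mem_realSetCode]
  constructor
  · rintro ⟨h1, ⟨t₁, -, ht₁⟩, ⟨t₂, ht₂T, ht₂⟩, h4, h5⟩
    obtain ⟨t₁, -, rfl⟩ := mem_tripleSetCode.1 (h1 _ ht₁)
    obtain ⟨t₂, -, rfl⟩ := mem_tripleSetCode.1 ht₂T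
    have hdown : ∀ t t', tripleCode t ∈ r → tripleVal t' < tripleVal t → tripleCode t' ∈ r :=
      fun t t' ht htt' => h4 _ ht _ (hT t') (pair_mem_ltCode.2 htt')
    have hne : (tripleVal '' {t | tripleCode t ∈ r}).Nonempty := ⟨_, mem_image_of_mem _ ht₁⟩
    have hbd : BddAbove (tripleVal '' {t | tripleCode t ∈ r}) := by
      refine ⟨tripleVal t₂, ?_⟩
      rintro _ ⟨t, ht, rfl⟩
      by_contra hlt
      exact ht₂ (hdown t t₂ ht (not_le.1 hlt))
    -- The cut is open because it has no largest element, so it is the set of triples with value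
    -- strictly below its supremum.
    refine ⟨sSup (tripleVal '' {t | tripleCode t ∈ r}), ?_⟩
    ext z
    rw [mem_realCode]
    constructor
    · rintro ⟨t, ht, rfl⟩
      obtain ⟨_, ⟨t', ht', rfl⟩, htt'⟩ := exists_lt_of_lt_csSup hne ht
      exact hdown t' t ht' htt'
    · intro hz
      obtain ⟨t, -, rfl⟩ := mem_tripleSetCode.1 (h1 _ hz)
      obtain ⟨t', ht', htt'⟩ := h5 _ hz
      obtain ⟨t', -, rfl⟩ := mem_tripleSetCode.1 (h1 _ ht')
      exact ⟨t, (pair_mem_ltCode.1 htt').trans_le (le_csSup hbd (mem_image_of_mem _ ht')), rfl⟩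
  · rintro ⟨x, rfl⟩
    obtain ⟨t₁, -, ht₁⟩ := exists_tripleVal_btwn (sub_one_lt x)
    obtain ⟨t₂, ht₂, -⟩ := exists_tripleVal_btwn (lt_add_one x)
    refine ⟨fun t ht => ?_, ⟨_, hT t₁, tripleCode_mem_realCode.2 ht₁⟩,
      ⟨_, hT t₂, fun h => ht₂.not_gt (tripleCode_mem_realCode.1 h)⟩, fun t ht t' ht' hlt => ?_,
      fun t ht => ?_⟩
    · obtain ⟨t, -, rfl⟩ := mem_realCode.1 ht
      exact hT t
    · obtain ⟨t, htx, rfl⟩ := mem_realCode.1 ht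
      obtain ⟨t', -, rfl⟩ := mem_tripleSetCode.1 ht'
      exact tripleCode_mem_realCode.2 ((pair_mem_ltCode.1 hlt).trans htx)
    · obtain ⟨t, htx, rfl⟩ := mem_realCode.1 ht
      obtain ⟨t', h1, h2⟩ := exists_tripleVal_btwn htx
      exact ⟨_, tripleCode_mem_realCode.2 h2, pair_mem_ltCode.2 h1⟩

/-- `H(χ)` contains the sets from which the real numbers are built. -/
structure HasReals (χ : Cardinal.{u}) : Prop where
  omega : omegaCode ∈ HSet χ
  add : tripleSetCode addGraph ∈ HSet χ
  mul : tripleSetCode mulGraph ∈ HSet χ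
  triples : tripleSetCode univ ∈ HSet χ
  lt : ltCode ∈ HSet χ
  reals : realSetCode ∈ HSet χ

section

variable {χ : Cardinal.{u}} {S : setLang.ElementarySubstructure (HSet χ)}

local notation "MM" => Subtype.val '' (S : Set (HSet χ))

theorem HasReals.realSetCode_mem (h : HasReals χ) : realSetCode ∈ MM := by
  have : Fact (tripleSetCode univ ∈ MM) := ⟨tripleSetCode_univ_mem h.omega h.triples⟩
  have : Fact (ltCode ∈ MM) := ⟨ltCode_mem h.omega h.add h.mul h.triples h.lt⟩
  -- Quantifying over `H(χ)` loses nothing: members of `R` and of `realSetCode` are themselves in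
  -- `H(χ)`.
  refine mem_of_def (P := fun R => ∀ r ∈ HSet χ, IsCut r ↔ r ∈ R) inferInstance h.reals
    (fun r _ => isCut_iff) fun y hy hP => ?_
  ext r
  constructor
  · intro hr
    exact isCut_iff.1 ((hP r (mem_HSet_of_mem hy hr)).2 hr)
  · intro hr
    exact (hP r (mem_HSet_of_mem h.reals hr)).1 (isCut_iff.2 hr)

theorem HasReals.tripleCode_mem (h : HasReals χ) (t : ℕ × ℕ × ℕ) : tripleCode t ∈ MM := by
  have : Fact (natCode t.1 ∈ MM) := ⟨natCode_mem h.omega _⟩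
  have : Fact (natCode t.2.1 ∈ MM) := ⟨natCode_mem h.omega _⟩
  have : Fact (natCode t.2.2 ∈ MM) := ⟨natCode_mem h.omega _⟩
  exact mem_of_def (P := fun z => z = ZFSet.pair (natCode t.1)
    (ZFSet.pair (natCode t.2.1) (natCode t.2.2))) inferInstance
    (mem_HSet_of_mem h.triples (tripleCode_mem_tripleSetCode.2 (mem_univ t))) rfl
    fun y _ hy => hy

theorem HasReals.realCode_tripleVal_mem (h : HasReals χ) (t : ℕ × ℕ × ℕ) :
    realCode (tripleVal t) ∈ MM := by
  have : Fact (realSetCode ∈ MM) := ⟨h.realSetCode_mem⟩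
  have : Fact (tripleCode t ∈ MM) := ⟨h.tripleCode_mem t⟩
  -- The strict cut of a rational is the largest cut that omits the triple representing it.
  refine mem_of_def (P := fun r => r ∈ realSetCode ∧ tripleCode t ∉ r ∧
    ∀ r' ∈ realSetCode, tripleCode t ∉ r' → r' ⊆ r) inferInstance
    (mem_HSet_of_mem h.reals (realCode_mem_realSetCode _)) ?_ ?_
  · simp only [forall_mem_realSetCode, tripleCode_mem_realCode, realCode_subset_iff, not_lt,
      le_refl, imp_self, implies_true, and_true]
    exact realCode_mem_realSetCode _
  · rintro y - ⟨hy, h1, h2⟩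
    obtain ⟨r, rfl⟩ := mem_realSetCode.1 hy
    simp only [forall_mem_realSetCode, tripleCode_mem_realCode, realCode_subset_iff, not_lt]
      at h1 h2
    rw [le_antisymm h1 (h2 _ le_rfl)]

theorem HasReals.realCode_zero_mem (h : HasReals χ) : realCode 0 ∈ MM := by
  have := h.realCode_tripleVal_mem (S := S) (0, 0, 0)
  simpa [tripleVal] using this

end

end

/-! ### Functions on `X` inside an elementary submodel -/

section

open Set FirstOrder

section

variable {X : Type u} {c : X → ZFSet.{u}}

theorem forall_mem_subsetCode_univ {P : ZFSet.{u} → Prop} :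
    (∀ x ∈ subsetCode c univ, P x) ↔ ∀ x, P (c x) := by
  simp [subsetCode]

theorem mem_subsetCode {U : Set X} {z : ZFSet.{u}} : z ∈ subsetCode c U ↔ ∃ x ∈ U, c x = z := by
  simp [subsetCode]

theorem apply_mem_subsetCode (hc : Function.Injective c) {U : Set X} {x : X} :
    c x ∈ subsetCode c U ↔ x ∈ U := by
  simp [mem_subsetCode, hc.eq_iff]

theorem subsetCode_subset (U : Set X) : subsetCode c U ⊆ subsetCode c univ := fun z hz => by
  obtain ⟨x, -, rfl⟩ := mem_subsetCode.1 hz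
  exact mem_subsetCode.2 ⟨x, mem_univ x, rfl⟩

theorem pair_mem_funCode (hc : Function.Injective c) {f : X → ℝ} {x : X} {r : ℝ} :
    ZFSet.pair (c x) (realCode r) ∈ funCode c f ↔ f x = r := by
  simp [funCode, ZFSet.pair_inj, hc.eq_iff, realCode_inj]

theorem funCode_injective (hc : Function.Injective c) : Function.Injective (funCode c) :=
  fun f g h => funext fun x => by
    have := (pair_mem_funCode hc (f := f) (x := x) (r := f x)).2 rfl
    rw [h, pair_mem_funCode hc] at this
    exact this.symm

theorem funCode_subset_prod (f : X → ℝ) :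
    funCode c f ⊆ ZFSet.prod (subsetCode c univ) realSetCode := fun z hz => by
  obtain ⟨x, rfl⟩ := ZFSet.mem_range.1 hz
  exact ZFSet.pair_mem_prod.2
    ⟨mem_subsetCode.2 ⟨x, mem_univ x, rfl⟩, realCode_mem_realSetCode _⟩

/-- The sequence of functions `f` as a set. -/
noncomputable def seqCode (c : X → ZFSet.{u}) (f : ℕ → X → ℝ) : ZFSet.{u} :=
  ZFSet.range fun n => ZFSet.pair (natCode n) (funCode c (f n))

theorem pair_mem_seqCode {f : ℕ → X → ℝ} {n : ℕ} {z : ZFSet.{u}} :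
    ZFSet.pair (natCode n) z ∈ seqCode c f ↔ funCode c (f n) = z := by
  simp [seqCode, ZFSet.pair_inj, natCode_inj]

variable [TopologicalSpace X]

/-- The topology of `X` as a set. -/
noncomputable def topologyCode (c : X → ZFSet.{u}) : ZFSet.{u} :=
  ZFSet.range fun U : {U : Set X // IsOpen U} => subsetCode c U.1

theorem exists_mem_topologyCode {P : ZFSet.{u} → Prop} :
    (∃ x ∈ topologyCode c, P x) ↔ ∃ U : Set X, IsOpen U ∧ P (subsetCode c U) := by
  simp [topologyCode]

/-- `g` is the graph of a continuous function. -/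
abbrev IsContinuousCode (c : X → ZFSet.{u}) (g : ZFSet.{u}) : Prop :=
  (∀ z ∈ g, ∃ x ∈ subsetCode c univ, ∃ r ∈ realSetCode, z = ZFSet.pair x r) ∧
  (∀ x ∈ subsetCode c univ, ∃ r ∈ realSetCode, ∀ r' ∈ realSetCode,
    (ZFSet.pair x r' ∈ g ↔ r' = r)) ∧
  ∀ q ∈ realSetCode,
    (∃ U ∈ topologyCode c, ∀ x ∈ subsetCode c univ, (x ∈ U ↔
      ∃ r ∈ realSetCode, ZFSet.pair x r ∈ g ∧ q ⊆ r ∧ q ≠ r)) ∧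
    ∃ U ∈ topologyCode c, ∀ x ∈ subsetCode c univ, (x ∈ U ↔
      ∃ r ∈ realSetCode, ZFSet.pair x r ∈ g ∧ r ⊆ q ∧ r ≠ q)

/-- Continuity into `ℝ` only concerns preimages of open rays, so it is expressible with the coded
topology and inclusion of cuts. -/
theorem isContinuousCode_iff (hc : Function.Injective c) {g : ZFSet.{u}} :
    IsContinuousCode c g ↔ ∃ f : C(X, ℝ), g = funCode c f := by
  have hlt : ∀ x y : ℝ, (realCode.{u} x ⊆ realCode y ∧ realCode.{u} x ≠ realCode y) ↔ x < y :=
    fun x y => by rw [realCode_subset_iff, Ne, realCode_inj, lt_iff_le_and_ne]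
  simp only [IsContinuousCode, forall_mem_subsetCode_univ, forall_mem_realSetCode,
    exists_mem_realSetCode, exists_mem_topologyCode, apply_mem_subsetCode hc, hlt, realCode_inj]
  constructor
  · rintro ⟨h1, h2, h3⟩
    choose f hf using h2
    have hg : g = funCode c f := by
      ext z
      rw [funCode, ZFSet.mem_range]
      constructor
      · intro hz
        obtain ⟨_, hx, r, rfl⟩ := h1 z hz
        obtain ⟨x, -, rfl⟩ := mem_subsetCode.1 hx
        exact ⟨x, by rw [(hf x r).1 hz]⟩
      · rintro ⟨x, rfl⟩
        exact (hf x _).2 rfl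
    have hcont : Continuous f := by
      refine OrderTopology.continuous_iff.2 fun q => ?_
      obtain ⟨⟨U, hU, hUq⟩, V, hV, hVq⟩ := h3 q
      simp only [hf, exists_eq_left] at hUq hVq
      have h1 : f ⁻¹' Ioi q = U := by
        ext x
        exact (hUq x).symm
      have h2 : f ⁻¹' Iio q = V := by
        ext x
        exact (hVq x).symm
      rw [h1, h2]
      exact ⟨hU, hV⟩
    exact ⟨⟨f, hcont⟩, hg⟩
  · rintro ⟨f, rfl⟩
    simp only [pair_mem_funCode hc, exists_eq_left']
    refine ⟨fun z hz => ?_, fun x => ⟨f x, fun r => eq_comm⟩, fun q =>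
      ⟨⟨{x | q < f x}, isOpen_lt continuous_const f.continuous, fun x => Iff.rfl⟩,
        {x | f x < q}, isOpen_lt f.continuous continuous_const, fun x => Iff.rfl⟩⟩
    obtain ⟨x, rfl⟩ := ZFSet.mem_range.1 hz
    exact ⟨c x, mem_subsetCode.2 ⟨x, mem_univ x, rfl⟩, f x, rfl⟩

/-- `H(χ)` contains the sets from which the functions on `X` are built. -/
structure HasSpace (c : X → ZFSet.{u}) (χ : Cardinal.{u}) : Prop extends HasReals χ where
  space : spaceCode c ∈ HSet χ
  functions : ZFSet.powerset (ZFSet.prod (subsetCode c univ) realSetCode) ∈ HSet χ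
  sequences : ZFSet.powerset (ZFSet.prod omegaCode
    (ZFSet.powerset (ZFSet.prod (subsetCode c univ) realSetCode))) ∈ HSet χ

theorem exists_forall_hasSpace (c : X → ZFSet.{u}) :
    ∃ χ₀ : Cardinal.{u}, ∀ χ, χ₀ ≤ χ → HasSpace c χ := by
  obtain ⟨χ₀, h⟩ := exists_forall_mem_HSet ({omegaCode, tripleSetCode addGraph,
    tripleSetCode mulGraph, tripleSetCode univ, ltCode, realSetCode, spaceCode c,
    ZFSet.powerset (ZFSet.prod (subsetCode c univ) realSetCode),
    ZFSet.powerset (ZFSet.prod omegaCode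
      (ZFSet.powerset (ZFSet.prod (subsetCode c univ) realSetCode)))} : ZFSet.{u})
  refine ⟨χ₀, fun χ hχ => ?_⟩
  have h' := fun z hz => mem_HSet_of_mem (y := z) (h χ hχ) hz
  exact ⟨⟨h' _ (by simp), h' _ (by simp), h' _ (by simp), h' _ (by simp), h' _ (by simp),
    h' _ (by simp)⟩, h' _ (by simp), h' _ (by simp), h' _ (by simp)⟩

section

variable {χ : Cardinal.{u}} {S : setLang.ElementarySubstructure (HSet χ)}

local notation "MM" => Subtype.val '' (S : Set (HSet χ))

theorem HasSpace.subsetCode_univ_mem_HSet (h : HasSpace c χ) :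
    subsetCode c univ ∈ HSet χ ∧ topologyCode c ∈ HSet χ := by
  have h1 : ({subsetCode c univ, topologyCode c} : ZFSet) ∈ HSet χ :=
    mem_HSet_of_mem h.space (by rw [spaceCode, ZFSet.pair]; exact ZFSet.mem_pair.2 (Or.inr rfl))
  exact ⟨mem_HSet_of_mem h1 (by simp), mem_HSet_of_mem h1 (by simp)⟩

theorem HasSpace.funCode_mem_HSet (h : HasSpace c χ) (f : X → ℝ) : funCode c f ∈ HSet χ :=
  mem_HSet_of_mem h.functions (ZFSet.mem_powerset.2 (funCode_subset_prod f))

theorem HasSpace.seqCode_mem_HSet (h : HasSpace c χ) (f : ℕ → X → ℝ) : seqCode c f ∈ HSet χ := by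
  refine mem_HSet_of_mem h.sequences (ZFSet.mem_powerset.2 fun z hz => ?_)
  obtain ⟨n, rfl⟩ := ZFSet.mem_range.1 hz
  exact ZFSet.pair_mem_prod.2
    ⟨natCode_mem_omegaCode n, ZFSet.mem_powerset.2 (funCode_subset_prod _)⟩

theorem HasSpace.subsetCode_univ_mem (h : HasSpace c χ) (hM : spaceCode c ∈ MM) :
    subsetCode c univ ∈ MM := by
  have : Fact (spaceCode c ∈ MM) := ⟨hM⟩
  refine mem_of_def (P := fun x => ∃ w ∈ spaceCode c, ∃ y ∈ w, spaceCode c = ZFSet.pair x y)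
    inferInstance h.subsetCode_univ_mem_HSet.1 ⟨{subsetCode c univ, topologyCode c},
      ?_, topologyCode c, by simp, rfl⟩ ?_
  · rw [spaceCode, ZFSet.pair]
    exact ZFSet.mem_pair.2 (Or.inr rfl)
  · rintro x - ⟨-, -, y, -, hxy⟩
    exact (ZFSet.pair_inj.1 hxy).1.symm

theorem HasSpace.topologyCode_mem (h : HasSpace c χ) (hM : spaceCode c ∈ MM) :
    topologyCode c ∈ MM := by
  have : Fact (spaceCode c ∈ MM) := ⟨hM⟩
  have : Fact (subsetCode c univ ∈ MM) := ⟨h.subsetCode_univ_mem hM⟩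
  refine mem_of_def (P := fun y => spaceCode c = ZFSet.pair (subsetCode c univ) y)
    inferInstance h.subsetCode_univ_mem_HSet.2 rfl fun y _ hy => (ZFSet.pair_inj.1 hy).2.symm

/-- The given function need not be in `M`, but having a prescribed co-zero set is definable from
parameters in `M`, so elementarity yields another one there. -/
theorem HasSpace.exists_function_of_isCozero (hc : Function.Injective c) (h : HasSpace c χ)
    (hM : spaceCode c ∈ MM) {U : Set X} (hU : IsCozero U) (hUM : subsetCode c U ∈ MM) :
    ∃ f ∈ functionsIn c MM, U = {x | f x ≠ 0} := by
  have : Fact (subsetCode c univ ∈ MM) := ⟨h.subsetCode_univ_mem hM⟩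
  have : Fact (topologyCode c ∈ MM) := ⟨h.topologyCode_mem hM⟩
  have : Fact (realSetCode ∈ MM) := ⟨h.realSetCode_mem⟩
  have : Fact (realCode 0 ∈ MM) := ⟨h.realCode_zero_mem⟩
  have : Fact (subsetCode c U ∈ MM) := ⟨hUM⟩
  obtain ⟨f, hf⟩ := hU
  obtain ⟨g, hg, hgc, hgU⟩ := exists_mem_of_def (S := S) (P := fun g => IsContinuousCode c g ∧
    ∀ x ∈ subsetCode c univ, (x ∈ subsetCode c U ↔ ¬ ZFSet.pair x (realCode 0) ∈ g))
    inferInstance (h.funCode_mem_HSet f) ⟨(isContinuousCode_iff hc).2 ⟨f, rfl⟩, by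
      simp only [forall_mem_subsetCode_univ, apply_mem_subsetCode hc, pair_mem_funCode hc]
      intro x
      rw [hf]
      rfl⟩
  obtain ⟨f', rfl⟩ := (isContinuousCode_iff hc).1 hgc
  simp only [forall_mem_subsetCode_univ, apply_mem_subsetCode hc, pair_mem_funCode hc] at hgU
  exact ⟨f', hg, ext hgU⟩

theorem HasSpace.subsetCode_lt_mem (hc : Function.Injective c) (h : HasSpace c χ)
    (hM : spaceCode c ∈ MM) {f : C(X, ℝ)} (hf : f ∈ functionsIn c MM) {q : ℝ}
    (hq : realCode q ∈ MM) :
    subsetCode c {x | f x < q} ∈ MM ∧ subsetCode c {x | q < f x} ∈ MM := by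
  have : Fact (subsetCode c univ ∈ MM) := ⟨h.subsetCode_univ_mem hM⟩
  have : Fact (realSetCode ∈ MM) := ⟨h.realSetCode_mem⟩
  have : Fact (realCode q ∈ MM) := ⟨hq⟩
  have : Fact (funCode c f ∈ MM) := ⟨hf⟩
  have hlt : ∀ x y : ℝ, (realCode.{u} x ⊆ realCode y ∧ realCode.{u} x ≠ realCode y) ↔ x < y :=
    fun x y => by rw [realCode_subset_iff, Ne, realCode_inj, lt_iff_le_and_ne]
  have huniq : ∀ (U : Set X) (y : ZFSet.{u}), y ⊆ subsetCode c univ →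
      (∀ x, c x ∈ y ↔ x ∈ U) → y = subsetCode c U := fun U y hy hyU => by
    ext z
    constructor
    · intro hz
      obtain ⟨x, -, rfl⟩ := mem_subsetCode.1 (hy hz)
      exact (apply_mem_subsetCode hc).2 ((hyU x).1 hz)
    · intro hz
      obtain ⟨x, hx, rfl⟩ := mem_subsetCode.1 hz
      exact (hyU x).2 hx
  constructor
  · refine mem_of_def (P := fun u => u ⊆ subsetCode c univ ∧ ∀ x ∈ subsetCode c univ, (x ∈ u ↔
      ∃ r ∈ realSetCode, ZFSet.pair x r ∈ funCode c f ∧ r ⊆ realCode q ∧ r ≠ realCode q))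
      inferInstance (mem_HSet_of_subset h.subsetCode_univ_mem_HSet.1 (subsetCode_subset _)) ?_ ?_ <;>
    simp only [forall_mem_subsetCode_univ, exists_mem_realSetCode, apply_mem_subsetCode hc, hlt,
      pair_mem_funCode hc, exists_eq_left']
    · exact ⟨subsetCode_subset _, fun x => Iff.rfl⟩
    · exact fun y _ hy => huniq _ y hy.1 hy.2
  · refine mem_of_def (P := fun u => u ⊆ subsetCode c univ ∧ ∀ x ∈ subsetCode c univ, (x ∈ u ↔
      ∃ r ∈ realSetCode, ZFSet.pair x r ∈ funCode c f ∧ realCode q ⊆ r ∧ realCode q ≠ r))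
      inferInstance (mem_HSet_of_subset h.subsetCode_univ_mem_HSet.1 (subsetCode_subset _)) ?_ ?_ <;>
    simp only [forall_mem_subsetCode_univ, exists_mem_realSetCode, apply_mem_subsetCode hc, hlt,
      pair_mem_funCode hc, exists_eq_left']
    · exact ⟨subsetCode_subset _, fun x => Iff.rfl⟩
    · exact fun y _ hy => huniq _ y hy.1 hy.2

-- The existence of a sequence of continuous functions separating triples holds in `H(χ)`, so some
-- such `s` lies in `M`. Each of its terms is definable from `s` and a natural number, hence also
-- lies in `M`.
set_option synthInstance.maxHeartbeats 200000 in
set_option synthInstance.maxSize 2048 in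
theorem HasSpace.exists_separating_family (hc : Function.Injective c) (h : HasSpace c χ)
    (hM : spaceCode c ∈ MM) {f : ℕ → C(X, ℝ)}
    (hf : ∀ x y z : X, x ≠ y → x ≠ z → y ≠ z → ∃ n, ¬ (f n x = f n y ∧ f n x = f n z)) :
    ∀ x y z : X, x ≠ y → x ≠ z → y ≠ z →
      ∃ g ∈ functionsIn c MM, ¬ (g x = g y ∧ g x = g z) := by
  have : Fact (subsetCode c univ ∈ MM) := ⟨h.subsetCode_univ_mem hM⟩
  have : Fact (topologyCode c ∈ MM) := ⟨h.topologyCode_mem hM⟩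
  have : Fact (realSetCode ∈ MM) := ⟨h.realSetCode_mem⟩
  have : Fact (omegaCode ∈ MM) := ⟨omegaCode_mem h.omega⟩
  obtain ⟨s, hs, hs1, hs2⟩ := exists_mem_of_def (S := S) (P := fun s =>
    (∀ n ∈ omegaCode, ∃ g ∈ HSet χ, IsContinuousCode c g ∧
      ∀ g' ∈ HSet χ, (ZFSet.pair n g' ∈ s ↔ g' = g)) ∧
    ∀ x ∈ subsetCode c univ, ∀ y ∈ subsetCode c univ, ∀ z ∈ subsetCode c univ,
      x ≠ y → x ≠ z → y ≠ z → ∃ n ∈ omegaCode, ∃ g ∈ HSet χ, ZFSet.pair n g ∈ s ∧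
        ¬ ∃ r ∈ realSetCode, ZFSet.pair x r ∈ g ∧ ZFSet.pair y r ∈ g ∧ ZFSet.pair z r ∈ g)
    inferInstance (h.seqCode_mem_HSet fun n => f n) (by
      simp only [forall_mem_subsetCode_univ, forall_mem_omegaCode, exists_mem_omegaCode,
        exists_mem_realSetCode, pair_mem_seqCode, hc.ne_iff]
      refine ⟨fun n => ⟨_, h.funCode_mem_HSet (f n), (isContinuousCode_iff hc).2 ⟨_, rfl⟩,
        fun g _ => eq_comm⟩, fun x y z hxy hxz hyz => ?_⟩
      obtain ⟨n, hn⟩ := hf x y z hxy hxz hyz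
      refine ⟨n, _, h.funCode_mem_HSet (f n), rfl, ?_⟩
      simp only [pair_mem_funCode hc]
      rintro ⟨r, h1, h2, h3⟩
      exact hn ⟨h1.trans h2.symm, h1.trans h3.symm⟩)
  have : Fact (s ∈ MM) := ⟨hs⟩
  simp only [forall_mem_subsetCode_univ, forall_mem_omegaCode, exists_mem_omegaCode,
    exists_mem_realSetCode, hc.ne_iff] at hs1 hs2
  intro x y z hxy hxz hyz
  obtain ⟨n, g, hg, hgs, hn⟩ := hs2 x y z hxy hxz hyz
  obtain ⟨g', -, hg'c, hg'⟩ := hs1 n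
  obtain rfl := (hg' g hg).1 hgs
  have : Fact (natCode n ∈ MM) := ⟨natCode_mem h.omega n⟩
  have hgM : g ∈ MM := mem_of_def (P := fun g => ZFSet.pair (natCode n) g ∈ s) inferInstance hg
    hgs fun g'' hg'' h' => (hg' g'' hg'').1 h'
  obtain ⟨f', rfl⟩ := (isContinuousCode_iff hc).1 hg'c
  refine ⟨f', hgM, fun hxyz => hn ?_⟩
  simp only [pair_mem_funCode hc]
  exact ⟨f' x, rfl, hxyz.1.symm, hxyz.2.symm⟩

/-- Downward Löwenheim–Skolem, for a countable language and an infinite structure. -/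
theorem HasSpace.exists_countable_elementarySubmodel (h : HasSpace c χ) :
    ∃ M : Set ZFSet.{u}, IsElementarySubmodel χ M ∧ M.Countable ∧ spaceCode c ∈ M := by
  have hinf : Infinite (HSet χ) := Infinite.of_injective
    (fun n : ℕ => (⟨natCode n, mem_HSet_of_mem h.omega (natCode_mem_omegaCode n)⟩ : HSet χ))
    fun m n hmn => natCode_injective (Subtype.ext_iff.1 hmn)
  have hcard : setLang.card ≤ Cardinal.aleph0 := by
    have : Countable setLang.Symbols := by
      have h1 : IsEmpty (Σ l, setLang.Functions l) := ⟨fun x => Empty.elim x.2⟩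
      have h2 : Countable (Σ l, setLang.Relations l) := by
        refine Function.Injective.countable (f := fun x => x.1) ?_
        rintro ⟨_, ⟨⟩⟩ ⟨_, ⟨⟩⟩ _
        rfl
      exact inferInstanceAs (Countable ((Σ l, setLang.Functions l) ⊕ Σ l, setLang.Relations l))
    exact Cardinal.mk_le_aleph0_iff.2 this
  obtain ⟨S, hS, hSc⟩ := Language.exists_elementarySubstructure_card_eq setLang
    ({⟨spaceCode c, h.space⟩} : Set (HSet χ)) Cardinal.aleph0.{0} le_rfl (by simp)
    (by simpa using hcard) (by simp)
  refine ⟨_, ⟨S, rfl⟩, ?_, ⟨spaceCode c, h.space⟩, hS rfl, rfl⟩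
  refine Set.Countable.image ?_ _
  rw [← Cardinal.le_aleph0_iff_set_countable]
  simpa using hSc.le

end

end

end

end SepMN

/-! ### The main theorem -/

theorem mainTheorem2 (X : Type u) [TopologicalSpace X] [CompactSpace X] [T2Space X]
    [TopologicalSpace.SeparableSpace X] (hX : SepMN.MonotonicallyNormal X) :
    -- a map with fibres of size at most two onto a separable (compact) metric space
    (∃ (Y : Type u) (_ : MetricSpace Y) (g : X → Y),
      TopologicalSpace.SeparableSpace Y ∧ CompactSpace Y ∧ SecondCountableTopology Y ∧
      Continuous g ∧ Function.Surjective g ∧ ∀ y : Y, (g ⁻¹' {y}).encard ≤ 2) ∧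
    -- as the topological quotient by a countable family of continuous functions
    (∃ F : Set C(X, ℝ), F.Countable ∧
      CompactSpace (Quotient (SepMN.familySetoid F)) ∧
      TopologicalSpace.MetrizableSpace (Quotient (SepMN.familySetoid F)) ∧
      TopologicalSpace.SeparableSpace (Quotient (SepMN.familySetoid F)) ∧
      SecondCountableTopology (Quotient (SepMN.familySetoid F)) ∧
      ∀ y : Quotient (SepMN.familySetoid F),
        (Quotient.mk (SepMN.familySetoid F) ⁻¹' {y}).encard ≤ 2) ∧
    -- as the projection to `X/M`, for every countable elementary submodel `M` containing `X`
    (∀ c : X → ZFSet.{u}, Function.Injective c →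
      ∃ χ₀ : Cardinal.{u}, ∀ χ : Cardinal.{u}, χ₀ ≤ χ → χ.IsRegular →
        (∃ M : Set ZFSet.{u}, SepMN.IsElementarySubmodel χ M ∧ M.Countable ∧
          SepMN.spaceCode c ∈ M) ∧
        ∀ M : Set ZFSet.{u}, SepMN.IsElementarySubmodel χ M → M.Countable →
          SepMN.spaceCode c ∈ M →
          (SepMN.functionsIn c M).Countable ∧
          CompactSpace (SepMN.ModelQuotient c M) ∧
          TopologicalSpace.MetrizableSpace (SepMN.ModelQuotient c M) ∧
          TopologicalSpace.SeparableSpace (SepMN.ModelQuotient c M) ∧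
          SecondCountableTopology (SepMN.ModelQuotient c M) ∧
          Topology.IsQuotientMap (SepMN.modelProj c M) ∧
          ∀ y : SepMN.ModelQuotient c M, (SepMN.modelProj c M ⁻¹' {y}).encard ≤ 2) := by
  open SepMN in
  obtain ⟨H, hH⟩ := hX.exists_operator
  have : HereditarilyLindelofSpace X := hH.hereditarilyLindelofSpace
  have : PerfectlyNormalSpace X := perfectlyNormalSpace_of_hereditarilyLindelof
  obtain ⟨F, hFc, hF⟩ := hH.exists_countable_family
  have : Countable F := hFc
  have hemb := isClosedEmbedding_familyQuotient F
  have hmet : TopologicalSpace.MetrizableSpace (Quotient (familySetoid F)) :=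
    hemb.isEmbedding.metrizableSpace
  have hsc : SecondCountableTopology (Quotient (familySetoid F)) :=
    hemb.isEmbedding.secondCountableTopology
  have hsep : TopologicalSpace.SeparableSpace (Quotient (familySetoid F)) := inferInstance
  have hfib := encard_quotient_fiber_le (subset_refl F) hF
  refine ⟨⟨Quotient (familySetoid F), TopologicalSpace.metrizableSpaceMetric _, Quotient.mk _,
    hsep, inferInstance, hsc, continuous_quotient_mk', Quotient.mk_surjective, hfib⟩,
    ⟨F, hFc, inferInstance, hmet, hsep, hsc, hfib⟩, fun c hc => ?_⟩
  obtain ⟨χ₀, hχ₀⟩ := exists_forall_hasSpace c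
  refine ⟨χ₀, fun χ hχ _ => ⟨(hχ₀ χ hχ).exists_countable_elementarySubmodel, ?_⟩⟩
  rintro _ ⟨S, rfl⟩ hMc hM
  have h := hχ₀ χ hχ
  obtain ⟨hcomp, ht2, hquot⟩ := modelQuotient_properties
    (fun U hU hUM => h.exists_function_of_isCozero hc hM hU hUM) (fun f hf x y hxy => by
      -- A rational threshold is used because its code belongs to every elementary submodel of
      -- `H(χ)`.
      obtain ⟨t, h1, h2⟩ := exists_tripleVal_btwn hxy
      obtain ⟨h3, h4⟩ := h.subsetCode_lt_mem hc hM hf (h.realCode_tripleVal_mem t)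
      refine ⟨_, _, isCozero_of_isOpen (isOpen_lt f.continuous continuous_const),
        isCozero_of_isOpen (isOpen_lt continuous_const f.continuous), h3, h4, h1, h2, ?_⟩
      exact Set.disjoint_left.2 fun z (hz : f z < tripleVal t) (hz' : tripleVal t < f z) =>
        lt_asymm hz hz')
  have hsc' := secondCountableTopology_modelQuotient hc hMc
  refine ⟨?_, hcomp, inferInstance, inferInstance, hsc', hquot,
    encard_quotient_fiber_le subset_rfl fun x hx hxe => ?_⟩
  · exact hMc.preimage (f := fun f : C(X, ℝ) => funCode c f)
      ((funCode_injective hc).comp DFunLike.coe_injective)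
  -- Enumerating by `ℕ` requires a nonempty family; the zero function is harmless.
  · have hne : (insert 0 F).Nonempty := Set.insert_nonempty _ _
    obtain ⟨f, hf⟩ := (hFc.insert 0).exists_eq_range hne
    obtain ⟨g, hg, hgx⟩ := h.exists_separating_family hc hM (f := f) (fun x y z hxy hxz hyz => by
      by_contra! hcon
      refine hF ![x, y, z] ?_ ?_
      · intro i j hij
        fin_cases i <;> fin_cases j <;> simp_all
      · have key : ∀ i, FamilyEquiv F x (![x, y, z] i) := fun i f' hf' => by
          obtain ⟨n, rfl⟩ : f' ∈ Set.range f := hf ▸ Set.mem_insert_of_mem _ hf'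
          fin_cases i
          exacts [rfl, (hcon n).1, (hcon n).2]
        exact fun i j => (key i).symm.trans (key j))
      (x 0) (x 1) (x 2) (hx.ne (by decide)) (hx.ne (by decide)) (hx.ne (by decide))
    exact hgx ⟨hxe 0 1 g hg, hxe 0 2 g hg⟩
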